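/- A \emph{marked category} is a pair $(\mathcal P,E)$ of a small category $\mathcal P$ and a class $E$ of morphisms of $\mathcal P$ (the marked morphisms) containing all identities; a \emph{marked functor} is a functor sending marked morphisms to marked morphisms. Let $\mathrm{Cat}$ be the category of small categories and $\mathrm{Cat}^+$ the category of marked categories and marked functors. For a category $\mathcal C$, write $\mathcal C^\sharp$ for $\mathcal C$ with all morphisms marked. A marked functor $P\colon(\mathcal P,E)\to\mathcal C^\sharp$ is a \emph{cart-marked Grothendieck fibration} if $P\colon\mathcal P\to\mathcal C$ is a Grothendieck fibration and $E$ is exactly the class of $P$-cartesian morphisms. Let $[0]$ be the terminal category; $\mathrm{Cat}^+$ is identified with the slice $\mathrm{Cat}^+_{/[0]}$ by means of the unique marked functors $(\mathcal P,E)\to[0]^\sharp=[0]$. The functor $(-)^\natural\colon\mathrm{Cat}\to\mathrm{Cat}^+$ marks exactly the isomorphisms of a category. It has the left adjoint $\mathcal L\mathrm{oc}\colon\mathrm{Cat}^+\to\mathrm{Cat}$ sending $(\mathcal C,E)$ to the localization $\mathcal C[E^{-1}]$. (1) There is a model structure on $\mathrm{Cat}$ (the canonical one) whose weak equivalences are the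 equivalences of categories, whose cofibrations are the functors injective on objects, and whose fibrations are the isofibrations. (2) There is a model structure on $\mathrm{Cat}^+$ (the Grothendieck-fibration model structure over $[0]$) in which the cofibrations are the marked functors injective on objects, the fibrant objects are the $(\mathcal P,E)$ such that $(\mathcal P,E)\to[0]^\sharp$ is a cart-marked Grothendieck fibration, the weak equivalences between fibrant objects are the marked functors whose underlying functor is an equivalence of categories, and the fibrations between fibrant objects are the marked functors whose underlying functor is an isofibration. (A model structure is determined by its cofibrations and fibrant objects, so it is unique.) (3) With respect to these model structures, the adjunction $\mathcal L\mathrm{oc}\dashv(-)^\natural$ between $\mathrm{Cat}^+$ and $\mathrm{Cat}$ is a Quillen equivalence: $(-)^\natural$ preserves fibrations and trivial fibrations, and for every cofibrant $X$ in $\mathrm{Cat}^+$ and every fibrant $Y$ in $\mathrm{Cat}$, a functor $\mathcal L\mathrm{oc}(X)\to Y$ is a weak equivalence if and only if its adjunct $X\to Y^\natural$ is a weak equivalence. -/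

import Mathlib

open CategoryTheory HomotopicalAlgebra

universe u

namespace CategoryTheory

/-- A functor is an isofibration if every isomorphism `d ≅ F c` is the image under `F` of
some isomorphism `c' ≅ c`. -/
def Functor.IsIsofib {C D : Type*} [Category* C] [Category* D] (F : C ⥤ D) : Prop :=
  ∀ (c : C) (d : D) (g : d ≅ F.obj c), ∃ (c' : C) (f : c' ≅ c), F.IsHomLift g.hom f.hom

/-- A (small) marked category: a small category together with a class of marked morphisms
which contains the identities. -/
structure MarkedCat : Type (u + 1) where
  /-- the underlying category -/
  cat : Cat.{u, u}
  /-- the class of marked morphisms -/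
  marking : MorphismProperty cat
  marking_id (x : cat) : marking (𝟙 x)

namespace MarkedCat

/-- A marked functor: a functor which sends marked morphisms to marked morphisms. -/
@[ext]
structure Hom (X Y : MarkedCat.{u}) where
  /-- the underlying functor -/
  functor : X.cat ⥤ Y.cat
  map_marking {x x' : X.cat} (f : x ⟶ x') (hf : X.marking f) : Y.marking (functor.map f)

/-- The category `Cat⁺` of marked categories and marked functors. -/
instance : Category MarkedCat.{u} where
  Hom X Y := Hom X Y
  id X := { functor := 𝟭 X.cat, map_marking := fun _ hf => hf }
  comp F G :=
    { functor := F.functor ⋙ G.functor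
      map_marking := fun f hf => G.map_marking _ (F.map_marking f hf) }

@[ext]
lemma hom_ext {X Y : MarkedCat.{u}} {F G : X ⟶ Y} (h : F.functor = G.functor) : F = G :=
  Hom.ext h

@[simp]
lemma id_functor (X : MarkedCat.{u}) : Hom.functor (𝟙 X) = 𝟭 X.cat := rfl

@[simp]
lemma comp_functor {X Y Z : MarkedCat.{u}} (F : X ⟶ Y) (G : Y ⟶ Z) :
    (F ≫ G).functor = F.functor ⋙ G.functor := rfl

/-- The maximal marking `C♯` of a category `C`: all morphisms are marked. -/
def sharp (C : Cat.{u, u}) : MarkedCat.{u} where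
  cat := C
  marking := ⊤
  marking_id _ := trivial

/-- A marked functor `P : (P, E) ⟶ C♯` is a cart-marked Grothendieck fibration if its underlying
functor is a Grothendieck fibration and the marked morphisms are exactly the `P`-cartesian
morphisms (called strongly cartesian in Mathlib). -/
def IsCartMarkedFibration {X : MarkedCat.{u}} {C : Cat.{u, u}} (P : X ⟶ sharp C) : Prop :=
  P.functor.IsFibered ∧
    ∀ {x x' : X.cat} (f : x ⟶ x'),
      X.marking f ↔ P.functor.IsStronglyCartesian (P.functor.map f) f

/-- The terminal category `[0]`. -/
abbrev point : Cat.{u, u} := Cat.of (Discrete PUnit.{u + 1})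

/-- The unique marked functor `X ⟶ [0]♯`, by which `Cat⁺` is identified with `Cat⁺` over `[0]♯`. -/
def toPoint (X : MarkedCat.{u}) : X ⟶ sharp point.{u} where
  functor := Functor.star X.cat
  map_marking _ _ := trivial

lemma eq_toPoint {X : MarkedCat.{u}} (P : X ⟶ sharp point.{u}) : P = X.toPoint :=
  hom_ext (Functor.punit_ext' _ _)

/-- The functor `(-)♮ : Cat ⥤ Cat⁺` marking exactly the isomorphisms of a category. -/
def natural : Cat.{u, u} ⥤ MarkedCat.{u} where
  obj C :=
    { cat := C
      marking := MorphismProperty.isomorphisms C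
      marking_id := fun x => by
        simp only [MorphismProperty.isomorphisms.iff]
        infer_instance }
  map F :=
    { functor := F.toFunctor
      map_marking := fun f hf => by
        simp only [MorphismProperty.isomorphisms.iff] at hf ⊢
        infer_instance }

/-- A marked functor to `D♮` is the same as a functor to `D` that inverts the marked morphisms,
hence the same as a functor from the localization to `D`. -/
noncomputable def locHomEquiv (X : MarkedCat.{u}) (D : Cat.{u, u}) :
    (Cat.of X.marking.Localization ⟶ D) ≃ (X ⟶ natural.obj D) where
  toFun G :=
    { functor := X.marking.Q ⋙ G.toFunctor
      map_marking := fun f hf => by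
        exact (G.toFunctor.mapIso (Localization.Construction.wIso f hf)).isIso_hom }
  invFun F :=
    (Localization.Construction.lift (W := X.marking) (D := D) F.functor
      (fun _ _ f hf => F.map_marking f hf)).toCatHom
  left_inv G := by
    ext1
    exact Localization.Construction.uniq _ _ (Localization.Construction.fac _ _)
  right_inv F := hom_ext (Localization.Construction.fac _ _)

lemma Q_comp_lift_comp_lift {C D E : Type*} [Category* C] [Category* D] [Category* E]
    {W : MorphismProperty C} {W' : MorphismProperty D} (F : C ⥤ D) (G : D ⥤ E)
    (hF : W.IsInvertedBy (F ⋙ W'.Q)) (hG : W'.IsInvertedBy G) :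
    W.Q ⋙ (Localization.Construction.lift (F ⋙ W'.Q) hF ⋙ Localization.Construction.lift G hG) =
      F ⋙ G := by
  rw [← Functor.assoc, Localization.Construction.fac, Functor.assoc, Localization.Construction.fac]

/-- The functor `Loc : Cat⁺ ⥤ Cat` sending `(C, E)` to the localization `C[E⁻¹]`, and a marked
functor `F : (C, E) ⟶ (D, E')` to the unique functor `C[E⁻¹] ⥤ D[E'⁻¹]` compatible with `F` and
the localization functors. -/
noncomputable def loc : MarkedCat.{u} ⥤ Cat.{u, u} where
  obj X := Cat.of X.marking.Localization
  map {X Y} F :=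
    (Localization.Construction.lift (W := X.marking) (F.functor ⋙ Y.marking.Q)
      (fun _ _ f hf => Y.marking.Q_inverts _ (F.map_marking f hf))).toCatHom
  map_id X := by
    ext1
    exact Localization.Construction.uniq _ _ (Localization.Construction.fac _ _)
  map_comp {X Y Z} F G := by
    ext1
    refine Localization.Construction.uniq _ _ ((Localization.Construction.fac _ _).trans ?_)
    exact (Q_comp_lift_comp_lift (W := X.marking) (W' := Y.marking) F.functor
      (G.functor ⋙ Z.marking.Q) _ _).symm

/-- The adjunction `Loc ⊣ (-)♮`. -/
noncomputable def locAdj : loc.{u} ⊣ natural.{u} :=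
  Adjunction.mkOfHomEquiv
    { homEquiv := locHomEquiv
      homEquiv_naturality_left_symm := fun {X Y D} F G => by
        ext1
        refine Localization.Construction.uniq _ _ ((Localization.Construction.fac _ _).trans ?_)
        exact (Q_comp_lift_comp_lift _ _ _ _).symm
      homEquiv_naturality_right := fun _ _ => rfl }

end MarkedCat

/-- The unit of `Loc ⊣ (-)♮` is the localization functor `C ⥤ C[E⁻¹]`. -/
lemma MarkedCat.locAdj_unit_functor (X : MarkedCat.{u}) :
    MarkedCat.Hom.functor (MarkedCat.locAdj.unit.app X) = X.marking.Q := by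
  simp only [MarkedCat.locAdj, Adjunction.mkOfHomEquiv_unit_app]
  rfl

/-- A model structure on `Cat` is the canonical one if its weak equivalences are the equivalences
of categories, its cofibrations are the functors that are injective on objects and its fibrations
are the isofibrations. -/
structure IsCanonicalModelStructure (M : ModelCategory Cat.{u, u}) : Prop where
  weakEquivalence_iff {C D : Cat.{u, u}} (F : C ⟶ D) :
    WeakEquivalence F ↔ F.toFunctor.IsEquivalence
  cofibration_iff {C D : Cat.{u, u}} (F : C ⟶ D) :
    Cofibration F ↔ Function.Injective F.toFunctor.obj
  fibration_iff {C D : Cat.{u, u}} (F : C ⟶ D) :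
    Fibration F ↔ F.toFunctor.IsIsofib

/-- A model structure on `Cat⁺ ≅ Cat⁺ / [0]♯` is the model structure for Grothendieck fibrations
over `[0]` if its cofibrations are the marked functors that are injective on objects, its fibrant
objects are the cart-marked Grothendieck fibrations over `[0]`, and the weak equivalences
(resp. the fibrations) between fibrant objects are the marked functors whose underlying functor is
an equivalence of categories (resp. an isofibration). A model structure is determined by its
cofibrations and its fibrant objects, so there is at most one such model structure. -/
structure IsGrfibModelStructure (M : ModelCategory MarkedCat.{u}) : Prop where
  cofibration_iff {X Y : MarkedCat.{u}} (F : X ⟶ Y) :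
    Cofibration F ↔ Function.Injective F.functor.obj
  isFibrant_iff (X : MarkedCat.{u}) :
    IsFibrant X ↔ MarkedCat.IsCartMarkedFibration X.toPoint
  weakEquivalence_iff {X Y : MarkedCat.{u}} (F : X ⟶ Y) (hX : IsFibrant X) (hY : IsFibrant Y) :
    WeakEquivalence F ↔ F.functor.IsEquivalence
  fibration_iff {X Y : MarkedCat.{u}} (F : X ⟶ Y) (hX : IsFibrant X) (hY : IsFibrant Y) :
    Fibration F ↔ F.functor.IsIsofib

section Quillen

variable {C D : Type*} [Category* C] [Category* D] [ModelCategory C] [ModelCategory D]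
  {L : C ⥤ D} {R : D ⥤ C}

/-- A Quillen adjunction: the right adjoint preserves fibrations and trivial fibrations. -/
structure Adjunction.IsQuillenAdjunction (adj : L ⊣ R) : Prop where
  map_fibration {A B : D} (p : A ⟶ B) (hp : Fibration p) : Fibration (R.map p)
  map_trivialFibration {A B : D} (p : A ⟶ B) (hp : Fibration p) (hp' : WeakEquivalence p) :
    Fibration (R.map p) ∧ WeakEquivalence (R.map p)

/-- A Quillen equivalence: a Quillen adjunction such that, for `X` cofibrant and `Y` fibrant, a
morphism `L X ⟶ Y` is a weak equivalence if and only if its adjunct `X ⟶ R Y` is one. -/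
structure Adjunction.IsQuillenEquivalence (adj : L ⊣ R) : Prop
    extends Adjunction.IsQuillenAdjunction adj where
  weakEquivalence_iff {X : C} {Y : D} (hX : IsCofibrant X) (hY : IsFibrant Y) (f : L.obj X ⟶ Y) :
    WeakEquivalence f ↔ WeakEquivalence (adj.homEquiv X Y f)

end Quillen

end CategoryTheory

/-! On `Cat` the two factorizations are the mapping cylinder (objects of source and target,
morphisms computed in the target) and the mapping path category (triples of `c`, `d` and an
isomorphism `F c ≅ d`). The liftings are built by hand: full faithfulness forces the arrows of a
lift against a surjective equivalence, and conjugation by isomorphisms extends a lift along an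
injective equivalence.

On `Cat⁺` the weak equivalences are taken to be the marked functors inducing an equivalence on
localizations (`locEquivs`), and the fibrations are defined by lifting against the injective weak
equivalences. Localization does not change objects, so by adjunction these trivial cofibrations are
exactly the maps with the left lifting property against the images under `natural` of isofibrations
(`injOnObj_inf_locEquivs`). The trivial fibrations are the surjective equivalences reflecting
markings (`fibs_inf_locEquivs`). Lifting against the unit shows that the fibrant objects are those
whose marked arrows are the isomorphisms, which are also the cartesian arrows over a point.

The remaining axiom is the factorization into a trivial cofibration and a fibration. The small
object argument is applied to the trivial cofibrations between countable marked categories. To see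
that these generate, let `p` be a weak equivalence lifting against them. Localization, being a left
adjoint, preserves the presentation of `p` as a σ-directed union of countable pieces. Hence the
countably many instances of essential surjectivity, fullness and faithfulness concerning one piece
are settled in a larger one, and a union of ω such steps is a countable weak equivalence containing
any prescribed countable data (`hasCountableApproximations`). Lifting against the cylinders of these
approximations makes `p` a trivial fibration (`HasCountableApproximations.surjEquivs`), and the
retract argument concludes.

The Quillen equivalence is deduced from the stated properties of the two model structures alone. All
`natural.obj C` are fibrant, so `natural` preserves and reflects weak equivalences and fibrations;
what is left is that the unit is a weak equivalence (`weakEquivalence_unit`). -/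

namespace CategoryTheory

open Limits MorphismProperty

/-! ### Equalities in `Arrow C`, used instead of transport along equalities of objects. -/

section Arrows

variable {C D E : Type*} [Category* C] [Category* D] [Category* E]

lemma Arrow.mk_comp_congr {x y z x' y' z' : C} {f : x ⟶ y} {g : y ⟶ z} {f' : x' ⟶ y'}
    {g' : y' ⟶ z'} (hf : Arrow.mk f = Arrow.mk f') (hg : Arrow.mk g = Arrow.mk g') :
    Arrow.mk (f ≫ g) = Arrow.mk (f' ≫ g') := by
  obtain ⟨rfl, rfl, rfl⟩ := (Arrow.mk_eq_mk_iff _ _).1 hf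
  obtain ⟨h, rfl, rfl⟩ := (Arrow.mk_eq_mk_iff _ _).1 hg
  simp

lemma Arrow.left_congr {x y x' y' : C} {f : x ⟶ y} {f' : x' ⟶ y'}
    (hf : Arrow.mk f = Arrow.mk f') : x = x' :=
  congrArg Comma.left hf

lemma Arrow.right_congr {x y x' y' : C} {f : x ⟶ y} {f' : x' ⟶ y'}
    (hf : Arrow.mk f = Arrow.mk f') : y = y' :=
  congrArg Comma.right hf

lemma Arrow.mk_id_congr {x y : C} (h : x = y) : Arrow.mk (𝟙 x) = Arrow.mk (𝟙 y) := by
  subst h; rfl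

lemma Functor.mk_map_congr (F : C ⥤ D) {x y x' y' : C} {f : x ⟶ y} {f' : x' ⟶ y'}
    (hf : Arrow.mk f = Arrow.mk f') : Arrow.mk (F.map f) = Arrow.mk (F.map f') :=
  congrArg F.mapArrow.obj hf

lemma Functor.mk_map_congr_left {F G : C ⥤ D} (h : F = G) {x y : C} (f : x ⟶ y) :
    Arrow.mk (F.map f) = Arrow.mk (G.map f) := by
  subst h; rfl

variable (φ : Arrow C → Arrow D) (hid : ∀ x : C, ∃ y : D, φ (.mk (𝟙 x)) = .mk (𝟙 y))
  (hcomp : ∀ {x y z : C} (f : x ⟶ y) (g : y ⟶ z), ∃ (a b c : D) (f' : a ⟶ b) (g' : b ⟶ c),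
    φ (.mk f) = .mk f' ∧ φ (.mk g) = .mk g' ∧ φ (.mk (f ≫ g)) = .mk (f' ≫ g'))

-- Applied to `𝟙 x` and `f`, the hypothesis `hcomp` makes the two images consecutive, and the first
-- is an identity by `hid`.
include hid hcomp in
lemma Functor.ofArrows_left {x y : C} (f : x ⟶ y) :
    (φ (.mk f)).left = (φ (.mk (𝟙 x))).left := by
  obtain ⟨a, b, c, f', g', h₁, h₂, h₃⟩ := hcomp (𝟙 x) f
  obtain ⟨d, hd⟩ := hid x
  rw [h₂, hd]
  rw [hd] at h₁
  exact (Arrow.right_congr h₁).symm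

include hid hcomp in
lemma Functor.ofArrows_right {x y : C} (f : x ⟶ y) :
    (φ (.mk f)).right = (φ (.mk (𝟙 y))).left := by
  obtain ⟨a, b, c, f', g', h₁, h₂, h₃⟩ := hcomp f (𝟙 y)
  obtain ⟨d, hd⟩ := hid y
  rw [h₁, hd]
  rw [hd] at h₂
  exact (Arrow.left_congr h₂).symm

include hid hcomp in
lemma Functor.ofArrows_mk {x y : C} (f : x ⟶ y) :
    Arrow.mk (eqToHom (Functor.ofArrows_left φ hid hcomp f).symm ≫ (φ (.mk f)).hom ≫
      eqToHom (Functor.ofArrows_right φ hid hcomp f)) = φ (.mk f) := by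
  rw [Arrow.arrow_mk_eqToHom_comp, Arrow.arrow_mk_comp_eqToHom]
  rfl

/-- A functor defined by its action on arrows. -/
def Functor.ofArrows : C ⥤ D where
  obj x := (φ (.mk (𝟙 x))).left
  map {x y} f := eqToHom (Functor.ofArrows_left φ hid hcomp f).symm ≫ (φ (.mk f)).hom ≫
      eqToHom (Functor.ofArrows_right φ hid hcomp f)
  map_id x := by
    apply Arrow.mk_injective
    rw [Functor.ofArrows_mk φ hid hcomp]
    obtain ⟨y, hy⟩ := hid x
    conv_lhs => rw [hy]
    exact Arrow.mk_id_congr (congrArg Comma.left hy).symm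
  map_comp f g := by
    apply Arrow.mk_injective
    rw [Functor.ofArrows_mk φ hid hcomp]
    obtain ⟨a, b, c, f', g', h₁, h₂, h₃⟩ := hcomp f g
    rw [h₃]
    exact Arrow.mk_comp_congr (by rw [Functor.ofArrows_mk φ hid hcomp, h₁])
      (by rw [Functor.ofArrows_mk φ hid hcomp, h₂])

lemma Functor.ofArrows_map {x y : C} (f : x ⟶ y) :
    Arrow.mk ((Functor.ofArrows φ hid hcomp).map f) = φ (.mk f) :=
  Functor.ofArrows_mk φ hid hcomp f

end Arrows

/-! ### Tight cocones, an elementwise criterion for directed colimits of categories. -/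

namespace Cat

variable {J : Type*} [Preorder J] {F : J ⥤ Cat.{u, u}}

/-- A cocone of categories over a directed preorder is tight if every arrow of its point comes
from some stage, and arrows of a stage with the same image become equal at some later stage. -/
structure IsTight (c : Cocone F) : Prop where
  surj (a : Arrow c.pt) : ∃ (j : J) (b : Arrow (F.obj j)),
    (c.ι.app j).toFunctor.mapArrow.obj b = a
  inj (j : J) (a b : Arrow (F.obj j))
    (h : (c.ι.app j).toFunctor.mapArrow.obj a = (c.ι.app j).toFunctor.mapArrow.obj b) :
    ∃ (k : J) (u : j ⟶ k), (F.map u).toFunctor.mapArrow.obj a = (F.map u).toFunctor.mapArrow.obj b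

lemma mapArrow_w (c : Cocone F) {j k : J} (u : j ⟶ k) (a : Arrow (F.obj j)) :
    (c.ι.app k).toFunctor.mapArrow.obj ((F.map u).toFunctor.mapArrow.obj a) =
      (c.ι.app j).toFunctor.mapArrow.obj a := by
  rw [← c.w u]
  rfl

lemma obj_w (c : Cocone F) {j k : J} (u : j ⟶ k) (a : F.obj j) :
    (c.ι.app k).toFunctor.obj ((F.map u).toFunctor.obj a) = (c.ι.app j).toFunctor.obj a := by
  rw [← c.w u]
  rfl

lemma mapArrow_map_comp (F : J ⥤ Cat.{u, u}) {j k l : J} (u : j ⟶ k) (v : k ⟶ l)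
    (a : Arrow (F.obj j)) :
    (F.map (u ≫ v)).toFunctor.mapArrow.obj a =
      (F.map v).toFunctor.mapArrow.obj ((F.map u).toFunctor.mapArrow.obj a) := by
  rw [F.map_comp]
  rfl

namespace IsTight

variable {c : Cocone F} (hc : IsTight c)

include hc

lemma surj_obj (x : c.pt) : ∃ (j : J) (y : F.obj j), (c.ι.app j).toFunctor.obj y = x := by
  obtain ⟨j, b, h⟩ := hc.surj (.mk (𝟙 x))
  exact ⟨j, b.left, Arrow.left_congr h⟩

lemma inj_obj (j : J) (x y : F.obj j)
    (h : (c.ι.app j).toFunctor.obj x = (c.ι.app j).toFunctor.obj y) :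
    ∃ (k : J) (u : j ⟶ k), (F.map u).toFunctor.obj x = (F.map u).toFunctor.obj y := by
  obtain ⟨k, u, hu⟩ := hc.inj j (.mk (𝟙 x)) (.mk (𝟙 y)) (by
    simp only [Functor.mapArrow_obj, Arrow.mk_hom, Arrow.mk_left, Arrow.mk_right,
      Functor.map_id]
    exact Arrow.mk_id_congr h)
  exact ⟨k, u, Arrow.left_congr hu⟩

variable [IsDirectedOrder J]

lemma inj' {i j : J} (a : Arrow (F.obj i)) (b : Arrow (F.obj j))
    (h : (c.ι.app i).toFunctor.mapArrow.obj a = (c.ι.app j).toFunctor.mapArrow.obj b) :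
    ∃ (k : J) (u : i ⟶ k) (v : j ⟶ k),
      (F.map u).toFunctor.mapArrow.obj a = (F.map v).toFunctor.mapArrow.obj b := by
  obtain ⟨k, hik, hjk⟩ := exists_ge_ge i j
  obtain ⟨l, w, hw⟩ := hc.inj k ((F.map (homOfLE hik)).toFunctor.mapArrow.obj a)
    ((F.map (homOfLE hjk)).toFunctor.mapArrow.obj b) (by rw [mapArrow_w, mapArrow_w, h])
  refine ⟨l, homOfLE hik ≫ w, homOfLE hjk ≫ w, ?_⟩
  rw [mapArrow_map_comp, mapArrow_map_comp, hw]

/-- Lifts of `f` and `g` to a common stage need not be composable there. Their middle objects agree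
in the colimit, hence at a later stage, where an `eqToHom` joins them without changing the arrow. -/
lemma exists_comp {x y z : c.pt} (f : x ⟶ y) (g : y ⟶ z) :
    ∃ (j : J) (x' y' z' : F.obj j) (f' : x' ⟶ y') (g' : y' ⟶ z'),
      Arrow.mk ((c.ι.app j).toFunctor.map f') = Arrow.mk f ∧
      Arrow.mk ((c.ι.app j).toFunctor.map g') = Arrow.mk g := by
  obtain ⟨i, a, ha⟩ := hc.surj (.mk f)
  obtain ⟨j, b, hb⟩ := hc.surj (.mk g)
  obtain ⟨k, hik, hjk⟩ := exists_ge_ge i j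
  have ha' := (mapArrow_w c (homOfLE hik) a).trans ha
  have hb' := (mapArrow_w c (homOfLE hjk) b).trans hb
  generalize (F.map (homOfLE hik)).toFunctor.mapArrow.obj a = a' at ha'
  generalize (F.map (homOfLE hjk)).toFunctor.mapArrow.obj b = b' at hb'
  obtain ⟨l, w, hw⟩ := hc.inj_obj k a'.right b'.left
    ((Arrow.right_congr ha').trans (Arrow.left_congr hb').symm)
  rw [← mapArrow_w c w] at ha' hb'
  refine ⟨l, _, _, _, (F.map w).toFunctor.map a'.hom,
    eqToHom hw ≫ (F.map w).toFunctor.map b'.hom, ha', ?_⟩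
  exact (Functor.mk_map_congr _ (Arrow.arrow_mk_eqToHom_comp _ _)).trans hb'

section desc

variable (d : Cocone F)

/-- The action on arrows of the functor induced by a cocone. -/
noncomputable def descArrow (a : Arrow c.pt) : Arrow d.pt :=
  (d.ι.app (hc.surj a).choose).toFunctor.mapArrow.obj (hc.surj a).choose_spec.choose

/-- Independence of the chosen lift: two lifts of one arrow agree at a later stage, and `d` is
compatible with the transition functors. -/
lemma descArrow_eq {j : J} (b : Arrow (F.obj j)) :
    hc.descArrow d ((c.ι.app j).toFunctor.mapArrow.obj b) =
      (d.ι.app j).toFunctor.mapArrow.obj b := by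
  have h := (hc.surj ((c.ι.app j).toFunctor.mapArrow.obj b)).choose_spec.choose_spec
  obtain ⟨k, u, v, huv⟩ := hc.inj' _ _ h
  unfold descArrow
  rw [← mapArrow_w d u, huv, mapArrow_w d v]

lemma descArrow_eq' {j : J} {x y : F.obj j} (b : x ⟶ y) :
    hc.descArrow d (.mk ((c.ι.app j).toFunctor.map b)) =
      .mk ((d.ι.app j).toFunctor.map b) :=
  hc.descArrow_eq d (.mk b)

lemma descArrow_id (x : c.pt) : ∃ y : d.pt, hc.descArrow d (.mk (𝟙 x)) = .mk (𝟙 y) := by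
  obtain ⟨j, y, rfl⟩ := hc.surj_obj x
  exact ⟨(d.ι.app j).toFunctor.obj y, by
    rw [← Functor.map_id, descArrow_eq', Functor.map_id]⟩

lemma descArrow_comp {x y z : c.pt} (f : x ⟶ y) (g : y ⟶ z) :
    ∃ (a₁ a₂ a₃ : d.pt) (f' : a₁ ⟶ a₂) (g' : a₂ ⟶ a₃),
      hc.descArrow d (.mk f) = .mk f' ∧ hc.descArrow d (.mk g) = .mk g' ∧
        hc.descArrow d (.mk (f ≫ g)) = .mk (f' ≫ g') := by
  obtain ⟨j, x', y', z', f', g', hf, hg⟩ := hc.exists_comp f g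
  refine ⟨_, _, _, (d.ι.app j).toFunctor.map f', (d.ι.app j).toFunctor.map g', ?_, ?_, ?_⟩
  · rw [← hf, descArrow_eq']
  · rw [← hg, descArrow_eq']
  · rw [← Arrow.mk_comp_congr hf hg, ← Functor.map_comp, descArrow_eq', Functor.map_comp]

/-- The functor induced by a cocone. -/
noncomputable def desc : c.pt ⥤ d.pt :=
  Functor.ofArrows (hc.descArrow d) (hc.descArrow_id d) (hc.descArrow_comp d)

lemma desc_map {x y : c.pt} (f : x ⟶ y) :
    Arrow.mk ((hc.desc d).map f) = hc.descArrow d (.mk f) :=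
  Functor.ofArrows_map _ (hc.descArrow_id d) (hc.descArrow_comp d) f

/-- A tight cocone over a directed preorder is a colimit cocone. -/
noncomputable def isColimit : IsColimit c where
  desc d := (hc.desc d).toCatHom
  fac d j := by
    ext1
    apply Arrow.functor_ext
    intro x y f
    exact (hc.desc_map d _).trans (hc.descArrow_eq' d f)
  uniq d m hm := by
    ext1
    apply Arrow.functor_ext
    intro x y f
    refine Eq.trans ?_ (hc.desc_map d _).symm
    obtain ⟨j, b, hb⟩ := hc.surj (.mk f)
    rw [← hb]
    refine Eq.trans ?_ (hc.descArrow_eq d b).symm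
    rw [← hm]
    rfl

end desc

end IsTight

lemma IsTight.of_iso {c d : Cocone F} (hc : IsTight c) (e : c ≅ d) : IsTight d := by
  have key (j : J) (b : Arrow (F.obj j)) : e.inv.hom.toFunctor.mapArrow.obj
      ((d.ι.app j).toFunctor.mapArrow.obj b) = (c.ι.app j).toFunctor.mapArrow.obj b := by
    rw [← e.inv.w j]; rfl
  have key' (j : J) (b : Arrow (F.obj j)) : e.hom.hom.toFunctor.mapArrow.obj
      ((c.ι.app j).toFunctor.mapArrow.obj b) = (d.ι.app j).toFunctor.mapArrow.obj b := by
    rw [← e.hom.w j]; rfl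
  refine ⟨fun a => ?_, fun j a b h => hc.inj j a b ?_⟩
  · obtain ⟨j, b, hb⟩ := hc.surj (e.inv.hom.toFunctor.mapArrow.obj a)
    refine ⟨j, b, ?_⟩
    rw [← key', hb]
    have : e.inv.hom ≫ e.hom.hom = 𝟙 _ := by
      rw [← Cocone.category_comp_hom, e.inv_hom_id]; rfl
    change (e.inv.hom ≫ e.hom.hom).toFunctor.mapArrow.obj a = a
    rw [this]
    rfl
  · rw [← key, h, key]

end Cat

/-! ### Explicit construction of directed colimits of categories. -/

namespace Cat

/-- The functor sending a category to its set of arrows. -/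
def arrows : Cat.{u, u} ⥤ Type u where
  obj C := Arrow C
  map F := ↾F.toFunctor.mapArrow.obj

/-- The source of arrows, as a natural transformation. -/
def arrowsSrc : arrows.{u} ⟶ objects.{u, u} where
  app C := ↾fun f : Arrow C => f.left

/-- The target of arrows, as a natural transformation. -/
def arrowsTgt : arrows.{u} ⟶ objects.{u, u} where
  app C := ↾fun f : Arrow C => f.right

set_option linter.unusedSectionVars false

variable {J : Type u} [Preorder J] [IsDirectedOrder J] [Nonempty J] (F : J ⥤ Cat.{u, u})

namespace DirectedColimit

/-- The arrows of a directed colimit of categories. -/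
abbrev Arr : Type u := colimit (F ⋙ arrows)

/-- The objects of a directed colimit of categories. -/
abbrev Ob : Type u := colimit (F ⋙ objects)

variable {F}

/-- The arrow of the colimit given by an arrow of a stage. -/
noncomputable def mkArr {j : J} {x y : F.obj j} (f : x ⟶ y) : Arr F :=
  colimit.ι (F ⋙ arrows) j (Arrow.mk f)

/-- The object of the colimit given by an object of a stage. -/
noncomputable def mkOb {j : J} (x : F.obj j) : Ob F :=
  colimit.ι (F ⋙ objects) j x

lemma mkArr_eq_iff {i j : J} {x y : F.obj i} {x' y' : F.obj j} (f : x ⟶ y) (g : x' ⟶ y') :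
    mkArr f = mkArr g ↔ ∃ (k : J) (hi : i ≤ k) (hj : j ≤ k),
      Arrow.mk ((F.map (homOfLE hi)).toFunctor.map f) =
        Arrow.mk ((F.map (homOfLE hj)).toFunctor.map g) := by
  refine (Types.FilteredColimit.colimit_eq_iff _).trans ⟨?_, ?_⟩
  · rintro ⟨k, u, v, h⟩
    exact ⟨k, leOfHom u, leOfHom v, h⟩
  · rintro ⟨k, u, v, h⟩
    exact ⟨k, homOfLE u, homOfLE v, h⟩

lemma mkOb_eq_iff {i j : J} (x : F.obj i) (y : F.obj j) :
    mkOb x = mkOb y ↔ ∃ (k : J) (hi : i ≤ k) (hj : j ≤ k),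
      (F.map (homOfLE hi)).toFunctor.obj x = (F.map (homOfLE hj)).toFunctor.obj y := by
  refine (Types.FilteredColimit.colimit_eq_iff _).trans ⟨?_, ?_⟩
  · rintro ⟨k, u, v, h⟩
    exact ⟨k, leOfHom u, leOfHom v, h⟩
  · rintro ⟨k, u, v, h⟩
    exact ⟨k, homOfLE u, homOfLE v, h⟩

lemma mkArr_map {i j : J} (u : i ⟶ j) {x y : F.obj i} (f : x ⟶ y) :
    mkArr ((F.map u).toFunctor.map f) = mkArr f :=
  ConcreteCategory.congr_hom (colimit.w (F ⋙ arrows) u) (Arrow.mk f)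

lemma mkArr_congr {i : J} {x y x' y' : F.obj i} {f : x ⟶ y} {g : x' ⟶ y'}
    (h : Arrow.mk f = Arrow.mk g) : mkArr f = mkArr g := by
  unfold mkArr
  rw [h]

lemma exists_mkArr (a : Arr F) : ∃ (j : J) (x y : F.obj j) (f : x ⟶ y), mkArr f = a := by
  obtain ⟨j, f, rfl⟩ := Types.jointly_surjective' a
  exact ⟨j, _, _, f.hom, rfl⟩

lemma exists_mkOb (a : Ob F) : ∃ (j : J) (x : F.obj j), mkOb x = a :=
  Types.jointly_surjective' a

/-- The source of an arrow of the colimit. -/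
noncomputable def src : Arr F → Ob F :=
  colimMap (Functor.whiskerLeft F arrowsSrc)

/-- The target of an arrow of the colimit. -/
noncomputable def tgt : Arr F → Ob F :=
  colimMap (Functor.whiskerLeft F arrowsTgt)

lemma src_mkArr {j : J} {x y : F.obj j} (f : x ⟶ y) : src (mkArr f) = mkOb x :=
  ConcreteCategory.congr_hom (ι_colimMap (Functor.whiskerLeft F arrowsSrc) j) (Arrow.mk f)

lemma tgt_mkArr {j : J} {x y : F.obj j} (f : x ⟶ y) : tgt (mkArr f) = mkOb y :=
  ConcreteCategory.congr_hom (ι_colimMap (Functor.whiskerLeft F arrowsTgt) j) (Arrow.mk f)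

/-- Everything about composition in the colimit, associativity included, is checked on
representatives that are composable at one stage. -/
lemma exists_triple {a b c : Arr F} (hab : tgt a = src b) (hbc : tgt b = src c) :
    ∃ (j : J) (x y z t : F.obj j) (f : x ⟶ y) (g : y ⟶ z) (h : z ⟶ t),
      mkArr f = a ∧ mkArr g = b ∧ mkArr h = c := by
  obtain ⟨i₁, x₁, y₁, f₁, rfl⟩ := exists_mkArr a
  obtain ⟨i₂, x₂, y₂, f₂, rfl⟩ := exists_mkArr b
  obtain ⟨i₃, x₃, y₃, f₃, rfl⟩ := exists_mkArr c
  rw [tgt_mkArr, src_mkArr] at hab hbc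
  obtain ⟨k, h₁, h₂, e⟩ := (mkOb_eq_iff _ _).1 hab
  obtain ⟨k', h₂', h₃', e'⟩ := (mkOb_eq_iff _ _).1 hbc
  obtain ⟨l, hl, hl'⟩ := exists_ge_ge k k'
  have e₁ : (F.map (homOfLE (h₁.trans hl))).toFunctor.obj y₁ =
      (F.map (homOfLE (h₂.trans hl))).toFunctor.obj x₂ := by
    have := congrArg (F.map (homOfLE hl)).toFunctor.obj e
    rwa [← Cat.Hom.comp_obj, ← Cat.Hom.comp_obj, ← F.map_comp, ← F.map_comp] at this
  have e₂ : (F.map (homOfLE (h₂.trans hl))).toFunctor.obj y₂ =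
      (F.map (homOfLE (h₃'.trans hl'))).toFunctor.obj x₃ := by
    have := congrArg (F.map (homOfLE hl')).toFunctor.obj e'
    rwa [← Cat.Hom.comp_obj, ← Cat.Hom.comp_obj, ← F.map_comp, ← F.map_comp] at this
  refine ⟨l, _, _, _, _, (F.map (homOfLE (h₁.trans hl))).toFunctor.map f₁,
    eqToHom e₁ ≫ (F.map (homOfLE (h₂.trans hl))).toFunctor.map f₂,
    eqToHom e₂ ≫ (F.map (homOfLE (h₃'.trans hl'))).toFunctor.map f₃, mkArr_map _ _, ?_, ?_⟩
  · rw [mkArr_congr (Arrow.arrow_mk_eqToHom_comp _ _), mkArr_map]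
  · rw [mkArr_congr (Arrow.arrow_mk_eqToHom_comp _ _), mkArr_map]

lemma mkArr_id_congr {i j : J} {x : F.obj i} {y : F.obj j} (h : mkOb x = mkOb y) :
    mkArr (𝟙 x) = mkArr (𝟙 y) := by
  obtain ⟨k, hi, hj, e⟩ := (mkOb_eq_iff _ _).1 h
  refine (mkArr_eq_iff _ _).2 ⟨k, hi, hj, ?_⟩
  rw [Functor.map_id, Functor.map_id]
  exact Arrow.mk_id_congr e

lemma exists_pair {a b : Arr F} (hab : tgt a = src b) :
    ∃ (j : J) (x y z : F.obj j) (f : x ⟶ y) (g : y ⟶ z), mkArr f = a ∧ mkArr g = b := by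
  obtain ⟨i, x, y, f, rfl⟩ := exists_mkArr b
  obtain ⟨j, x, y, z, t, f, g, h, ha, hb, -⟩ := exists_triple (c := mkArr (𝟙 y)) hab
    (by rw [tgt_mkArr, src_mkArr])
  exact ⟨j, x, y, z, f, g, ha, hb⟩

/-- Composition in the colimit. -/
noncomputable def comp (a b : Arr F) (hab : tgt a = src b) : Arr F :=
  mkArr ((exists_pair hab).choose_spec.choose_spec.choose_spec.choose_spec.choose ≫
    (exists_pair hab).choose_spec.choose_spec.choose_spec.choose_spec.choose_spec.choose)

lemma mkArr_comp_congr {i j : J} {x y z : F.obj i} {x' y' z' : F.obj j}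
    {f : x ⟶ y} {g : y ⟶ z} {f' : x' ⟶ y'} {g' : y' ⟶ z'} (hf : mkArr f = mkArr f')
    (hg : mkArr g = mkArr g') : mkArr (f ≫ g) = mkArr (f' ≫ g') := by
  obtain ⟨k, h₁, h₂, e⟩ := (mkArr_eq_iff _ _).1 hf
  obtain ⟨k', h₁', h₂', e'⟩ := (mkArr_eq_iff _ _).1 hg
  obtain ⟨l, hl, hl'⟩ := exists_ge_ge k k'
  refine (mkArr_eq_iff _ _).2 ⟨l, h₁.trans hl, h₂.trans hl, ?_⟩
  rw [Functor.map_comp, Functor.map_comp]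
  apply Arrow.mk_comp_congr
  · have := congrArg (F.map (homOfLE hl)).toFunctor.mapArrow.obj e
    exact ((mapArrow_map_comp F (homOfLE h₁) (homOfLE hl) (.mk f)).trans this).trans
      (mapArrow_map_comp F (homOfLE h₂) (homOfLE hl) (.mk f')).symm
  · have := congrArg (F.map (homOfLE hl')).toFunctor.mapArrow.obj e'
    exact ((mapArrow_map_comp F (homOfLE h₁') (homOfLE hl') (.mk g)).trans this).trans
      (mapArrow_map_comp F (homOfLE h₂') (homOfLE hl') (.mk g')).symm

lemma comp_mkArr {j : J} {x y z : F.obj j} (f : x ⟶ y) (g : y ⟶ z)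
    (h : tgt (mkArr f) = src (mkArr g)) : comp (mkArr f) (mkArr g) h = mkArr (f ≫ g) :=
  have hs := (exists_pair h).choose_spec.choose_spec.choose_spec.choose_spec.choose_spec.choose_spec
  mkArr_comp_congr hs.1 hs.2

/-- The identity of an object of the colimit. -/
noncomputable def idArr (x : Ob F) : Arr F :=
  mkArr (𝟙 (exists_mkOb x).choose_spec.choose)

lemma idArr_mkOb {j : J} (x : F.obj j) : idArr (mkOb x) = mkArr (𝟙 x) :=
  mkArr_id_congr (exists_mkOb (mkOb x)).choose_spec.choose_spec

end DirectedColimit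

open DirectedColimit

/-- The colimit of a directed diagram of categories. -/
structure DirectedColimit where
  /-- the underlying object -/
  ob : Ob F

namespace DirectedColimit

variable {F}

noncomputable instance : Category.{u} (DirectedColimit F) where
  Hom x y := { a : Arr F // src a = x.ob ∧ tgt a = y.ob }
  id x := ⟨idArr x.ob, by
    obtain ⟨x⟩ := x
    obtain ⟨j, x, rfl⟩ := exists_mkOb x
    rw [idArr_mkOb, src_mkArr, tgt_mkArr]
    exact ⟨rfl, rfl⟩⟩
  comp a b := ⟨comp a.1 b.1 (a.2.2.trans b.2.1.symm), by
    obtain ⟨a, ha, ha'⟩ := a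
    obtain ⟨b, hb, hb'⟩ := b
    obtain ⟨j, x, y, z, f, g, rfl, rfl⟩ := exists_pair (ha'.trans hb.symm)
    rw [comp_mkArr, src_mkArr, tgt_mkArr]
    rw [src_mkArr] at ha
    rw [tgt_mkArr] at hb'
    exact ⟨ha, hb'⟩⟩
  id_comp a := by
    obtain ⟨a, ha, ha'⟩ := a
    obtain ⟨j, x, y, f, rfl⟩ := exists_mkArr a
    apply Subtype.ext
    have := ha.symm.trans (src_mkArr f)
    simp only [this, idArr_mkOb, comp_mkArr, Category.id_comp]
  comp_id a := by
    obtain ⟨a, ha, ha'⟩ := a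
    obtain ⟨j, x, y, f, rfl⟩ := exists_mkArr a
    apply Subtype.ext
    have := ha'.symm.trans (tgt_mkArr f)
    simp only [this, idArr_mkOb, comp_mkArr, Category.comp_id]
  assoc a b c := by
    obtain ⟨a, ha, ha'⟩ := a
    obtain ⟨b, hb, hb'⟩ := b
    obtain ⟨c, hc, hc'⟩ := c
    obtain ⟨j, x, y, z, t, f, g, h, rfl, rfl, rfl⟩ :=
      exists_triple (ha'.trans hb.symm) (hb'.trans hc.symm)
    apply Subtype.ext
    simp only [comp_mkArr, Category.assoc]

lemma arrow_ext {a b : Arrow (DirectedColimit F)} (h : a.hom.1 = b.hom.1) : a = b := by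
  obtain ⟨⟨x⟩, ⟨y⟩, ⟨a, ha, ha'⟩⟩ := a
  obtain ⟨⟨x'⟩, ⟨y'⟩, ⟨b, hb, hb'⟩⟩ := b
  obtain rfl : a = b := h
  obtain rfl : x = x' := ha.symm.trans hb
  obtain rfl : y = y' := ha'.symm.trans hb'
  rfl

variable (F)

/-- The functor from a stage to the colimit. -/
noncomputable def ι (j : J) : F.obj j ⥤ DirectedColimit F where
  obj x := ⟨mkOb x⟩
  map f := ⟨mkArr f, src_mkArr f, tgt_mkArr f⟩
  map_id x := Subtype.ext (idArr_mkOb x).symm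
  map_comp f g := Subtype.ext (comp_mkArr f g ((tgt_mkArr f).trans (src_mkArr g).symm)).symm

/-- The colimit cocone. -/
noncomputable def cocone : Cocone F where
  pt := Cat.of (DirectedColimit F)
  ι :=
    { app j := (ι F j).toCatHom
      naturality j k u := by
        ext1
        refine Arrow.functor_ext fun x y f => arrow_ext (mkArr_map u f) }

lemma isTight_cocone : IsTight (cocone F) where
  surj a := by
    obtain ⟨j, x, y, f, hf⟩ := exists_mkArr a.hom.1
    exact ⟨j, .mk f, arrow_ext hf⟩
  inj j a b h := by
    have : mkArr a.hom = mkArr b.hom :=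
      congrArg (fun c : Arrow (DirectedColimit F) => c.hom.1) h
    obtain ⟨k, u, v, e⟩ := (mkArr_eq_iff _ _).1 this
    exact ⟨k, homOfLE u, e⟩

end DirectedColimit

variable {F}

/-- The explicit colimit is tight, and tightness passes along the isomorphism between two colimit
cocones. This gives elementwise control of colimits known only by their universal property, such as
those preserved by `loc`. -/
lemma isTight_of_isColimit {c : Cocone F} (hc : IsColimit c) : IsTight c :=
  (DirectedColimit.isTight_cocone F).of_iso
    ((DirectedColimit.isTight_cocone F).isColimit.uniqueUpToIso hc)

end Cat

/-! ### Isofibrations, surjective equivalences and their lifting properties. -/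

section

variable {A B C D X Y : Type*} [Category* A] [Category* B] [Category* C] [Category* D]
  [Category* X] [Category* Y]

lemma Functor.isHomLift_iff_mk (p : X ⥤ Y) {a b : X} {R S : Y} (f : R ⟶ S) (φ : a ⟶ b) :
    p.IsHomLift f φ ↔ Arrow.mk (p.map φ) = Arrow.mk f := by
  constructor
  · intro h
    exact (Arrow.mk_eq_mk_iff _ _).2 ⟨IsHomLift.domain_eq p f φ, IsHomLift.codomain_eq p f φ,
      IsHomLift.fac' p f φ⟩
  · intro h
    obtain ⟨rfl, rfl, rfl⟩ := (Arrow.mk_eq_mk_iff _ _).1 h.symm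
    simp only [eqToHom_refl, Category.id_comp, Category.comp_id]
    infer_instance

lemma Functor.IsIsofib.exists_lift {p : X ⥤ Y} (hp : p.IsIsofib) (c : X) {d d' : Y}
    (g : d ≅ d') (hc : p.obj c = d') :
    ∃ (c' : X) (f : c' ≅ c), Arrow.mk (p.map f.hom) = Arrow.mk g.hom := by
  subst hc
  obtain ⟨c', f, h⟩ := hp c d g
  exact ⟨c', f, (p.isHomLift_iff_mk _ _).1 h⟩

lemma Functor.isIsofib_iff (p : X ⥤ Y) : p.IsIsofib ↔ ∀ (c : X) (d : Y) (g : d ≅ p.obj c),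
    ∃ (c' : X) (f : c' ≅ c), Arrow.mk (p.map f.hom) = Arrow.mk g.hom := by
  simp only [IsIsofib, isHomLift_iff_mk]

lemma Arrow.mk_inv_congr {x y x' y' : C} {e : x ≅ y} {e' : x' ≅ y'}
    (h : Arrow.mk e.hom = Arrow.mk e'.hom) : Arrow.mk e.inv = Arrow.mk e'.inv := by
  obtain rfl := Arrow.left_congr h
  obtain rfl := Arrow.right_congr h
  obtain rfl : e = e' := Iso.ext (Arrow.mk_injective _ _ h)
  rfl

lemma Functor.arrow_ext_of_faithful (p : X ⥤ Y) [p.Faithful] {a b : Arrow X}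
    (hl : a.left = b.left) (hr : a.right = b.right)
    (h : Arrow.mk (p.map a.hom) = Arrow.mk (p.map b.hom)) : a = b := by
  obtain ⟨a₁, a₂, a⟩ := a
  obtain ⟨b₁, b₂, b⟩ := b
  dsimp at a b hl hr h
  subst hl hr
  have := p.map_injective (Arrow.mk_injective _ _ h)
  subst this
  rfl

/-- A functor which is surjective on objects, full and faithful. -/
structure Functor.IsSurjEquiv (p : X ⥤ Y) : Prop where
  surj : Function.Surjective p.obj
  full : p.Full
  faithful : p.Faithful

lemma Functor.IsSurjEquiv.isEquivalence {p : X ⥤ Y} (hp : p.IsSurjEquiv) : p.IsEquivalence where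
  faithful := hp.faithful
  full := hp.full
  essSurj := ⟨fun y => by
    obtain ⟨x, rfl⟩ := hp.surj y
    exact ⟨x, ⟨Iso.refl _⟩⟩⟩

lemma Functor.IsSurjEquiv.isIsofib {p : X ⥤ Y} (hp : p.IsSurjEquiv) : p.IsIsofib := by
  rw [Functor.isIsofib_iff]
  intro c d g
  have := hp.full
  have := hp.faithful
  obtain ⟨c', rfl⟩ := hp.surj d
  exact ⟨c', p.preimageIso g, by simp⟩

lemma Functor.IsIsofib.isSurjEquiv {p : X ⥤ Y} (hp : p.IsIsofib) [p.IsEquivalence] :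
    p.IsSurjEquiv where
  surj y := by
    obtain ⟨c', f, h⟩ := hp.exists_lift (p.objPreimage y) (p.objObjPreimageIso y).symm rfl
    exact ⟨c', Arrow.left_congr h⟩
  full := inferInstance
  faithful := inferInstance

/-- Only the objects are chosen: the values are prescribed on the image of `i`, and come from
surjectivity of `p` elsewhere. Full faithfulness of `p` then determines the arrows, and
functoriality is checked after applying `p`. -/
lemma Functor.IsSurjEquiv.exists_lift {i : A ⥤ B} (hi : Function.Injective i.obj) {p : X ⥤ Y}
    (hp : p.IsSurjEquiv) (f : A ⥤ X) (g : B ⥤ Y) (w : f ⋙ p = i ⋙ g) :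
    ∃ l : B ⥤ X, i ⋙ l = f ∧ l ⋙ p = g := by
  have := hp.full
  have := hp.faithful
  obtain ⟨ob, h₁, h₂⟩ : ∃ ob : B → X, (∀ a, ob (i.obj a) = f.obj a) ∧
      ∀ b, p.obj (ob b) = g.obj b := by
    classical
    let ob (b : B) : X :=
      if h : ∃ a, i.obj a = b then f.obj h.choose else (hp.surj (g.obj b)).choose
    have h₁ (a : A) : ob (i.obj a) = f.obj a := by
      have h : ∃ a', i.obj a' = i.obj a := ⟨a, rfl⟩
      dsimp only [ob]
      rw [dif_pos h, hi h.choose_spec]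
    refine ⟨ob, h₁, fun b => ?_⟩
    by_cases h : ∃ a, i.obj a = b
    · obtain ⟨a, rfl⟩ := h
      rw [h₁]
      exact Functor.congr_obj w a
    · dsimp only [ob]
      rw [dif_neg h]
      exact (hp.surj (g.obj b)).choose_spec
  let l : B ⥤ X :=
    { obj := ob
      map φ := p.preimage (eqToHom (h₂ _) ≫ g.map φ ≫ eqToHom (h₂ _).symm)
      map_id b := p.map_injective (by simp)
      map_comp φ ψ := p.map_injective (by simp) }
  have hl : l ⋙ p = g := Functor.ext h₂ (fun _ _ φ => by simp [l])
  refine ⟨l, ?_, hl⟩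
  refine Arrow.functor_ext fun a a' φ => p.arrow_ext_of_faithful (h₁ _) (h₁ _) ?_
  exact (Functor.mk_map_congr_left hl (i.map φ)).trans (Functor.mk_map_congr_left w φ).symm

section IsofibLift

variable {i : A ⥤ B} {p : X ⥤ Y} (f : A ⥤ X) (g : B ⥤ Y) (w : f ⋙ p = i ⋙ g)

variable (i p) in
/-- The data needed to extend a lift to the object `b`. -/
structure IsofibLiftData (b : B) where
  /-- an object of the source isomorphic to `b` -/
  a : A
  /-- the isomorphism -/
  θ : b ≅ i.obj a
  /-- the value of the lift -/
  x : X
  /-- the isomorphism with the known value -/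
  ψ : x ≅ f.obj a
  h : Arrow.mk (p.map ψ.hom) = Arrow.mk (g.map θ.hom)

namespace IsofibLiftData

/-- The lifting data at an object of the source. -/
def self (a : A) : IsofibLiftData i p f g (i.obj a) where
  a := a
  θ := Iso.refl _
  x := f.obj a
  ψ := Iso.refl _
  h := by
    simp only [Iso.refl_hom, Functor.map_id]
    exact Arrow.mk_id_congr (Functor.congr_obj w a)

variable {f g}

include w in
lemma exists_section [i.IsEquivalence] (hi : Function.Injective i.obj) (hp : p.IsIsofib) :
    ∃ d : ∀ b, IsofibLiftData i p f g b, ∀ a, d (i.obj a) = self f g w a := by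
  classical
  have h (b : B) : Nonempty (IsofibLiftData i p f g b) := by
    obtain ⟨x, ψ, h⟩ := hp.exists_lift (f.obj (i.objPreimage b))
      (g.mapIso (i.objObjPreimageIso b).symm) (Functor.congr_obj w _)
    exact ⟨⟨_, (i.objObjPreimageIso b).symm, x, ψ, h⟩⟩
  -- On the image of `i` the data must be the trivial ones, so that the lift extends `f` strictly;
  -- injectivity makes the chosen preimage and the transport harmless.
  refine ⟨fun b => if hb : ∃ a, i.obj a = b then hb.choose_spec ▸ self f g w hb.choose
    else (h b).some, fun a => ?_⟩
  have hb : ∃ a', i.obj a' = i.obj a := ⟨a, rfl⟩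
  refine (dif_pos hb).trans ?_
  have key (a' : A) (e : i.obj a' = i.obj a) : e ▸ self f g w a' = self f g w a := by
    obtain rfl := hi e
    rfl
  exact key _ _

/-- The lift given by a choice of lifting data. -/
noncomputable def functor [i.IsEquivalence] (d : ∀ b, IsofibLiftData i p f g b) : B ⥤ X where
  obj b := (d b).x
  map {b b'} φ := (d b).ψ.hom ≫ f.map (i.preimage ((d b).θ.inv ≫ φ ≫ (d b').θ.hom)) ≫
    (d b').ψ.inv
  map_id b := by simp
  map_comp {b b' b''} φ φ' := by
    simp only [Category.assoc, Iso.inv_hom_id_assoc, Iso.cancel_iso_hom_left]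
    rw [← f.map_comp_assoc]
    congr 2
    apply i.map_injective
    simp

end IsofibLiftData

-- Each `b` is isomorphic to some `i a`, and the isofibration lifts that isomorphism to one ending
-- at `f a`. Conjugating by these isomorphisms turns `f`, applied to preimages of arrows under `i`,
-- into a functor on all of `B`.
open IsofibLiftData in
include w in
lemma Functor.IsIsofib.exists_lift_of_isEquivalence [i.IsEquivalence]
    (hi : Function.Injective i.obj) (hp : p.IsIsofib) :
    ∃ l : B ⥤ X, i ⋙ l = f ∧ l ⋙ p = g := by
  obtain ⟨d, hd⟩ := IsofibLiftData.exists_section w hi hp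
  refine ⟨IsofibLiftData.functor d, Arrow.functor_ext fun a a' φ => ?_,
    Arrow.functor_ext fun b b' φ => ?_⟩
  · have key (e : IsofibLiftData i p f g (i.obj a)) (e' : IsofibLiftData i p f g (i.obj a'))
        (he : e = self f g w a) (he' : e' = self f g w a') :
        Arrow.mk (e.ψ.hom ≫ f.map (i.preimage (e.θ.inv ≫ i.map φ ≫ e'.θ.hom)) ≫ e'.ψ.inv) =
          Arrow.mk (f.map φ) := by
      subst he he'
      dsimp only [self, Iso.refl]
      simp only [Category.id_comp, Category.comp_id, Functor.preimage_map]
    exact key _ _ (hd a) (hd a')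
  · have h₁ : Arrow.mk (p.map (d b').ψ.inv) = Arrow.mk (g.map (d b').θ.inv) :=
      Arrow.mk_inv_congr (e := p.mapIso (d b').ψ) (e' := g.mapIso (d b').θ) (d b').h
    have h₂ := Functor.mk_map_congr_left w (i.preimage ((d b).θ.inv ≫ φ ≫ (d b').θ.hom))
    dsimp at h₂
    rw [i.map_preimage] at h₂
    have := Arrow.mk_comp_congr (d b).h (Arrow.mk_comp_congr h₂ h₁)
    simp only [← Functor.map_comp] at this
    refine this.trans ?_
    simp

end IsofibLift

/-! ### Mapping cylinders and mapping path categories. -/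

section Factorizations

variable (F : C ⥤ D)

/-- The mapping cylinder of a functor: its objects are those of the source and of the target,
and morphisms are computed in the target. -/
abbrev MappingCylinder := InducedCategory D (Sum.elim F.obj id)

namespace MappingCylinder

/-- The inclusion of the source. -/
def inl : C ⥤ MappingCylinder F where
  obj c := Sum.inl c
  map f := InducedCategory.homMk (F.map f)

/-- The projection to the target. -/
abbrev proj : MappingCylinder F ⥤ D := inducedFunctor _

lemma inl_injective : Function.Injective (inl F).obj := fun _ _ h => Sum.inl_injective h

lemma isSurjEquiv_proj : (proj F).IsSurjEquiv where
  surj d := ⟨Sum.inr d, rfl⟩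
  full := inferInstance
  faithful := inferInstance

end MappingCylinder

/-- An object of the mapping path category of a functor. -/
structure MappingPathObj where
  /-- the object of the source -/
  c : C
  /-- the object of the target -/
  d : D
  /-- the isomorphism -/
  iso : F.obj c ≅ d

/-- The mapping path category of a functor. -/
abbrev MappingPath := InducedCategory C (MappingPathObj.c (F := F))

namespace MappingPath

/-- The inclusion of the source. -/
def incl : C ⥤ MappingPath F where
  obj c := ⟨c, F.obj c, Iso.refl _⟩
  map f := InducedCategory.homMk f

/-- The projection to the target. -/
def proj : MappingPath F ⥤ D where
  obj t := MappingPathObj.d t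
  map {t t'} f := t.iso.inv ≫ F.map f.hom ≫ t'.iso.hom

lemma incl_comp_proj : incl F ⋙ proj F = F :=
  Functor.ext (fun _ => rfl) (fun c c' f => by
    change 𝟙 (F.obj c) ≫ F.map f ≫ 𝟙 (F.obj c') = 𝟙 (F.obj c) ≫ F.map f ≫ 𝟙 (F.obj c')
    rfl)

lemma incl_injective : Function.Injective (incl F).obj := fun _ _ h =>
  congrArg MappingPathObj.c h

instance : (incl F).IsEquivalence where
  faithful := ⟨fun h => congrArg InducedCategory.Hom.hom h⟩
  full := ⟨fun f => ⟨f.hom, rfl⟩⟩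
  essSurj := ⟨fun t => ⟨t.c, ⟨InducedCategory.isoMk (Iso.refl _)⟩⟩⟩

lemma isIsofib_proj : (proj F).IsIsofib := by
  rw [Functor.isIsofib_iff]
  rintro ⟨c, d₀, φ⟩ d g
  change d ≅ d₀ at g
  refine ⟨⟨c, d, φ ≪≫ g.symm⟩, InducedCategory.isoMk (Iso.refl _), ?_⟩
  change Arrow.mk ((φ ≪≫ g.symm).inv ≫ F.map (𝟙 c) ≫ φ.hom) = Arrow.mk g.hom
  simp

end MappingPath

end Factorizations

end

/-! ### The canonical model structure on `Cat`. -/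

namespace Cat

/-- The equivalences of categories. -/
def equivs : MorphismProperty Cat.{u, u} := fun _ _ F => F.toFunctor.IsEquivalence

/-- The functors which are injective on objects. -/
def injOnObj : MorphismProperty Cat.{u, u} := fun _ _ F => Function.Injective F.toFunctor.obj

/-- The isofibrations. -/
def isofibs : MorphismProperty Cat.{u, u} := fun _ _ F => F.toFunctor.IsIsofib

/-- The functors which are surjective on objects, full and faithful. -/
def surjEquivs : MorphismProperty Cat.{u, u} := fun _ _ F => F.toFunctor.IsSurjEquiv

lemma isofibs_inf_equivs : isofibs.{u} ⊓ equivs = surjEquivs := by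
  ext X Y F
  exact ⟨fun ⟨h, (h' : F.toFunctor.IsEquivalence)⟩ => h.isSurjEquiv,
    fun h => ⟨h.isIsofib, h.isEquivalence⟩⟩

instance : equivs.{u}.HasTwoOutOfThreeProperty where
  comp_mem F G (_ : F.toFunctor.IsEquivalence) (_ : G.toFunctor.IsEquivalence) :=
    inferInstanceAs (F.toFunctor ⋙ G.toFunctor).IsEquivalence
  of_postcomp F G (_ : G.toFunctor.IsEquivalence)
      (_ : (F.toFunctor ⋙ G.toFunctor).IsEquivalence) :=
    Functor.isEquivalence_of_comp_right F.toFunctor G.toFunctor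
  of_precomp F G (_ : F.toFunctor.IsEquivalence)
      (_ : (F.toFunctor ⋙ G.toFunctor).IsEquivalence) :=
    Functor.isEquivalence_of_comp_left F.toFunctor G.toFunctor

instance : injOnObj.{u}.IsStableUnderRetracts where
  of_retract {X Y Z W F G} h hG x y hxy := by
    have h₁ (x : X) : h.r.left.toFunctor.obj (h.i.left.toFunctor.obj x) = x :=
      congrArg (fun F : X ⟶ X => F.toFunctor.obj x) h.retract_left
    have h₂ (x : X) : G.toFunctor.obj (h.i.left.toFunctor.obj x) =
        h.i.right.toFunctor.obj (F.toFunctor.obj x) :=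
      congrArg (fun F : X ⟶ W => F.toFunctor.obj x) h.i_w
    rw [← h₁ x, ← h₁ y]
    refine congrArg _ (hG ?_)
    rw [h₂, h₂, hxy]

lemma hasLiftingProperty_surjEquivs {A B X Y : Cat.{u, u}} (i : A ⟶ B) (p : X ⟶ Y)
    (hi : injOnObj i) (hp : surjEquivs p) : HasLiftingProperty i p where
  sq_hasLift {f g} sq := by
    obtain ⟨l, h₁, h₂⟩ := hp.exists_lift hi f.toFunctor g.toFunctor
      congr(($(sq.w)).toFunctor)
    exact ⟨⟨l.toCatHom, Cat.ext h₁, Cat.ext h₂⟩⟩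

lemma hasLiftingProperty_isofibs {A B X Y : Cat.{u, u}} (i : A ⟶ B) (p : X ⟶ Y)
    (hi : injOnObj i) (hi' : equivs i) (hp : isofibs p) : HasLiftingProperty i p where
  sq_hasLift {f g} sq := by
    have : i.toFunctor.IsEquivalence := hi'
    obtain ⟨l, h₁, h₂⟩ := hp.exists_lift_of_isEquivalence f.toFunctor g.toFunctor
      congr(($(sq.w)).toFunctor) hi
    exact ⟨⟨l.toCatHom, Cat.ext h₁, Cat.ext h₂⟩⟩

/-- The factorization through the mapping cylinder. -/
def cylinderFactorization {C D : Cat.{u, u}} (F : C ⟶ D) :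
    MapFactorizationData injOnObj surjEquivs F where
  Z := Cat.of (MappingCylinder F.toFunctor)
  i := (MappingCylinder.inl F.toFunctor).toCatHom
  p := (MappingCylinder.proj F.toFunctor).toCatHom
  hi := MappingCylinder.inl_injective F.toFunctor
  hp := MappingCylinder.isSurjEquiv_proj F.toFunctor

/-- The factorization through the mapping path category. -/
def pathFactorization {C D : Cat.{u, u}} (F : C ⟶ D) :
    MapFactorizationData (injOnObj ⊓ equivs) isofibs F where
  Z := Cat.of (MappingPath F.toFunctor)
  i := (MappingPath.incl F.toFunctor).toCatHom
  p := (MappingPath.proj F.toFunctor).toCatHom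
  fac := Cat.ext (MappingPath.incl_comp_proj F.toFunctor)
  hi := ⟨MappingPath.incl_injective F.toFunctor,
    inferInstanceAs (MappingPath.incl F.toFunctor).IsEquivalence⟩
  hp := MappingPath.isIsofib_proj F.toFunctor

instance : HasFactorization injOnObj.{u} surjEquivs := ⟨fun F => ⟨cylinderFactorization F⟩⟩

instance : HasFactorization (injOnObj.{u} ⊓ equivs) isofibs := ⟨fun F => ⟨pathFactorization F⟩⟩

instance : equivs.{u}.IsStableUnderRetracts where
  of_retract {X Y Z W F G} h (hG : G.toFunctor.IsEquivalence) := by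
    let e := G.toFunctor.asEquivalence
    -- The quasi-inverse of the retract includes its target into that of `G`, applies the
    -- quasi-inverse of `G`, and retracts.
    let η : 𝟭 X ≅ F.toFunctor ⋙ h.i.right.toFunctor ⋙ e.inverse ⋙ h.r.left.toFunctor :=
      eqToIso congr(($(h.retract_left)).toFunctor).symm ≪≫
        Functor.isoWhiskerLeft h.i.left.toFunctor
          (Functor.isoWhiskerRight e.unitIso h.r.left.toFunctor) ≪≫
        Functor.isoWhiskerRight (eqToIso congr(($(h.i_w)).toFunctor))
          (e.inverse ⋙ h.r.left.toFunctor)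
    let ε : (h.i.right.toFunctor ⋙ e.inverse ⋙ h.r.left.toFunctor) ⋙ F.toFunctor ≅ 𝟭 Y :=
      Functor.isoWhiskerLeft (h.i.right.toFunctor ⋙ e.inverse)
        (eqToIso congr(($(h.r_w)).toFunctor)) ≪≫
        Functor.isoWhiskerLeft h.i.right.toFunctor
          (Functor.isoWhiskerRight e.counitIso h.r.right.toFunctor) ≪≫
        eqToIso congr(($(h.retract_right)).toFunctor)
    exact (Equivalence.mk F.toFunctor _ η ε).isEquivalence_functor

instance : isofibs.{u}.IsStableUnderRetracts where
  of_retract {X Y Z W F G} h hG := by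
    refine (Functor.isIsofib_iff _).2 fun c d g => ?_
    obtain ⟨z, f, hf⟩ := Functor.IsIsofib.exists_lift hG (h.i.left.toFunctor.obj c)
      (h.i.right.toFunctor.mapIso g) congr(($(h.i_w)).toFunctor.obj c)
    have hc : h.r.left.toFunctor.obj (h.i.left.toFunctor.obj c) = c :=
      congr(($(h.retract_left)).toFunctor.obj c)
    refine ⟨h.r.left.toFunctor.obj z, h.r.left.toFunctor.mapIso f ≪≫ eqToIso hc, ?_⟩
    rw [Iso.trans_hom, eqToIso.hom]
    refine (F.toFunctor.mk_map_congr (Arrow.arrow_mk_comp_eqToHom _ hc)).trans ?_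
    refine (Functor.mk_map_congr_left congr(($(h.r_w)).toFunctor) f.hom).trans ?_
    refine (h.r.right.toFunctor.mk_map_congr hf).trans ?_
    exact Functor.mk_map_congr_left congr(($(h.retract_right)).toFunctor) g.hom

instance : surjEquivs.{u}.IsStableUnderRetracts := by
  rw [← isofibs_inf_equivs]
  infer_instance

instance : IsWeakFactorizationSystem injOnObj.{u} surjEquivs :=
  .mk' _ _ hasLiftingProperty_surjEquivs

instance : IsWeakFactorizationSystem (injOnObj.{u} ⊓ equivs) isofibs :=
  .mk' _ _ fun i p hi hp => hasLiftingProperty_isofibs i p hi.1 hi.2 hp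

/-- The canonical model structure on `Cat`. -/
@[reducible]
def canonicalModelStructure : ModelCategory Cat.{u, u} :=
  letI : CategoryWithWeakEquivalences Cat.{u, u} := ⟨equivs⟩
  letI : CategoryWithCofibrations Cat.{u, u} := ⟨injOnObj⟩
  letI : CategoryWithFibrations Cat.{u, u} := ⟨isofibs⟩
  haveI : (weakEquivalences Cat.{u, u}).HasTwoOutOfThreeProperty :=
    inferInstanceAs equivs.{u}.HasTwoOutOfThreeProperty
  haveI : IsWeakFactorizationSystem (cofibrations Cat.{u, u}) (trivialFibrations Cat) := by
    change IsWeakFactorizationSystem injOnObj.{u} (isofibs ⊓ equivs)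
    rw [isofibs_inf_equivs]
    infer_instance
  haveI : IsWeakFactorizationSystem (trivialCofibrations Cat.{u, u}) (fibrations Cat) :=
    inferInstanceAs (IsWeakFactorizationSystem (injOnObj.{u} ⊓ equivs) isofibs)
  ModelCategory.mk' _

lemma isCanonicalModelStructure : IsCanonicalModelStructure canonicalModelStructure.{u} where
  weakEquivalence_iff F := by
    let _ := canonicalModelStructure.{u}
    exact HomotopicalAlgebra.weakEquivalence_iff F
  cofibration_iff F := by
    let _ := canonicalModelStructure.{u}
    exact HomotopicalAlgebra.cofibration_iff F
  fibration_iff F := by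
    let _ := canonicalModelStructure.{u}
    exact HomotopicalAlgebra.fibration_iff F

end Cat

/-! ### Limits and colimits of marked categories. -/

namespace MarkedCat

lemma marking_congr (X : MarkedCat.{u}) {a b a' b' : X.cat} {f : a ⟶ b} {f' : a' ⟶ b'}
    (h : Arrow.mk f = Arrow.mk f') : X.marking f ↔ X.marking f' := by
  obtain ⟨rfl, rfl, rfl⟩ := (Arrow.mk_eq_mk_iff _ _).1 h
  simp

/-- The functor forgetting the marking. -/
def forget : MarkedCat.{u} ⥤ Cat.{u, u} where
  obj X := X.cat
  map F := F.functor.toCatHom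

section

variable {J : Type*} [Category* J] {F : J ⥤ MarkedCat.{u}}

/-- The condition that every marked morphism of the point of a cocone is an identity or comes from
a marked morphism. -/
def IsMarkedTight (c : Cocone F) : Prop :=
  ∀ ⦃x y : c.pt.cat⦄ (f : x ⟶ y), c.pt.marking f →
    (∃ z, Arrow.mk f = Arrow.mk (𝟙 z)) ∨ ∃ (j : J) (a b : (F.obj j).cat) (g : a ⟶ b),
      (F.obj j).marking g ∧ Arrow.mk ((c.ι.app j).functor.map g) = Arrow.mk f

lemma IsMarkedTight.map_marking {c : Cocone F} (hm : IsMarkedTight c) {Z : MarkedCat.{u}}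
    (G : c.pt.cat ⥤ Z.cat) (φ : ∀ j, F.obj j ⟶ Z)
    (h : ∀ j, (c.ι.app j).functor ⋙ G = (φ j).functor) {x y : c.pt.cat} (f : x ⟶ y)
    (hf : c.pt.marking f) : Z.marking (G.map f) := by
  obtain ⟨z, hz⟩ | ⟨j, a, b, g, hg, e⟩ := hm f hf
  · rw [Z.marking_congr (Functor.mk_map_congr _ hz), Functor.map_id]
    exact Z.marking_id _
  · rw [Z.marking_congr (Functor.mk_map_congr _ e.symm)]
    exact (Z.marking_congr (Functor.mk_map_congr_left (h j) g)).2 ((φ j).map_marking g hg)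

/-- A cocone of marked categories is colimit if the underlying cocone of categories is, and if
the marking is generated by the images of the marked morphisms. -/
def isColimitOfForget {c : Cocone F} (hc : IsColimit (forget.mapCocone c))
    (hm : IsMarkedTight c) : IsColimit c where
  desc d :=
    { functor := (hc.desc (forget.mapCocone d)).toFunctor
      map_marking f hf := hm.map_marking _ d.ι.app
        (fun j => congr(($(hc.fac (forget.mapCocone d) j)).toFunctor)) f hf }
  fac d j := hom_ext congr(($(hc.fac (forget.mapCocone d) j)).toFunctor)
  uniq d m hm := hom_ext (congrArg Cat.Hom.toFunctor
    (hc.uniq (forget.mapCocone d) (forget.map m) fun j => congrArg forget.map (hm j)))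

/-- The marked category structure on the point of a cocone of categories. -/
def markedPt (c : Cocone (F ⋙ forget)) : MarkedCat.{u} where
  cat := c.pt
  marking _ _ f := (∃ z, Arrow.mk f = Arrow.mk (𝟙 z)) ∨ ∃ (j : J) (a b : (F.obj j).cat)
    (g : a ⟶ b), (F.obj j).marking g ∧ Arrow.mk ((c.ι.app j).toFunctor.map g) = Arrow.mk f
  -- The alternative of being an identity is needed for arbitrary cocones, whose legs may miss
  -- objects of the point.
  marking_id x := Or.inl ⟨x, rfl⟩

/-- The marked cocone on a cocone of categories. -/
def markedCocone (c : Cocone (F ⋙ forget)) : Cocone F where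
  pt := markedPt c
  ι :=
    { app j :=
        { functor := (c.ι.app j).toFunctor
          map_marking g hg := Or.inr ⟨j, _, _, g, hg, rfl⟩ }
      naturality _ _ u := hom_ext congr(($(c.ι.naturality u)).toFunctor) }

lemma isMarkedTight_markedCocone (c : Cocone (F ⋙ forget)) : IsMarkedTight (markedCocone c) :=
  fun _ _ _ hf => hf

/-- The marked cocone on a colimit cocone is colimit. -/
def isColimitMarkedCocone {c : Cocone (F ⋙ forget)} (hc : IsColimit c) :
    IsColimit (markedCocone c) :=
  isColimitOfForget (c := markedCocone c)
    (IsColimit.ofIsoColimit hc (Cocone.ext (Iso.refl _))) (isMarkedTight_markedCocone c)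

lemma IsMarkedTight.of_iso {c d : Cocone F} (hc : IsMarkedTight c) (e : c ≅ d) :
    IsMarkedTight d := by
  intro x y f hf
  have he : e.inv.hom ≫ e.hom.hom = 𝟙 _ := congrArg CoconeMorphism.hom e.inv_hom_id
  have he' : Arrow.mk (e.hom.hom.functor.map (e.inv.hom.functor.map f)) = Arrow.mk f :=
    Functor.mk_map_congr_left (congrArg Hom.functor he) f
  obtain ⟨z, hz⟩ | ⟨j, a, b, g, hg, h⟩ := hc _ (e.inv.hom.map_marking f hf)
  · refine Or.inl ⟨e.hom.hom.functor.obj z, he'.symm.trans ?_⟩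
    rw [← Functor.map_id]
    exact Functor.mk_map_congr _ hz
  · refine Or.inr ⟨j, a, b, g, hg, Eq.trans ?_ he'⟩
    refine Eq.trans ?_ (Functor.mk_map_congr _ h)
    exact Functor.mk_map_congr_left (congrArg Hom.functor (e.hom.w j).symm) g

/-- The marked category structure on the point of a cone of categories. -/
def conePt (c : Cone (F ⋙ forget)) : MarkedCat.{u} where
  cat := c.pt
  marking _ _ f := ∀ j, (F.obj j).marking ((c.π.app j).toFunctor.map f)
  marking_id x j := by
    rw [Functor.map_id]
    exact (F.obj j).marking_id _

/-- The marked cone on a cone of categories. -/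
def markedCone (c : Cone (F ⋙ forget)) : Cone F where
  pt := conePt c
  π :=
    { app j :=
        { functor := (c.π.app j).toFunctor
          map_marking _ hg := hg j }
      naturality _ _ u := hom_ext congr(($(c.π.naturality u)).toFunctor) }

/-- The marked cone on a limit cone is limit. -/
def isLimitMarkedCone {c : Cone (F ⋙ forget)} (hc : IsLimit c) :
    IsLimit (markedCone c) where
  lift d :=
    { functor := (hc.lift (forget.mapCone d)).toFunctor
      map_marking {x y} f hf j := by
        refine ((F.obj j).marking_congr (Functor.mk_map_congr_left
          congr(($(hc.fac (forget.mapCone d) j)).toFunctor) f)).2 ?_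
        exact (d.π.app j).map_marking f hf }
  fac d j := hom_ext congr(($(hc.fac (forget.mapCone d) j)).toFunctor)
  uniq d m hm := hom_ext (congrArg Cat.Hom.toFunctor
    (hc.uniq (forget.mapCone d) (forget.map m) fun j => congrArg forget.map (hm j)))

end

instance : HasColimits MarkedCat.{u} where
  has_colimits_of_shape _ _ :=
    ⟨fun _ => ⟨⟨_, isColimitMarkedCocone (colimit.isColimit _)⟩⟩⟩

instance : HasLimits MarkedCat.{u} where
  has_limits_of_shape _ _ :=
    ⟨fun _ => ⟨⟨_, isLimitMarkedCone (limit.isLimit _)⟩⟩⟩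

instance : PreservesColimits forget.{u} where
  preservesColimitsOfShape {J _} :=
    ⟨fun {F} => preservesColimit_of_preserves_colimit_cocone
      (isColimitMarkedCocone (colimit.isColimit (F ⋙ forget)))
      (IsColimit.ofIsoColimit (colimit.isColimit (F ⋙ forget)) (Cocone.ext (Iso.refl _)))⟩

lemma isMarkedTight_of_isColimit {J : Type u} [SmallCategory J] {F : J ⥤ MarkedCat.{u}}
    {c : Cocone F} (hc : IsColimit c) : IsMarkedTight c :=
  (isMarkedTight_markedCocone (colimit.cocone (F ⋙ forget))).of_iso
    ((isColimitMarkedCocone (colimit.isColimit (F ⋙ forget))).uniqueUpToIso hc)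

end MarkedCat

/-! ### Weak equivalences, cofibrations and fibrations of marked categories. -/

namespace MarkedCat

/-- The marked functors inducing an equivalence on localizations. -/
def locEquivs : MorphismProperty MarkedCat.{u} := Cat.equivs.inverseImage loc

/-- The marked functors which are injective on objects. -/
def injOnObj : MorphismProperty MarkedCat.{u} := Cat.injOnObj.inverseImage forget

/-- The marked functors which are surjective on objects, fully faithful, and reflect markings. -/
def surjEquivs : MorphismProperty MarkedCat.{u} := fun X Y F =>
  F.functor.IsSurjEquiv ∧ ∀ ⦃x x' : X.cat⦄ (f : x ⟶ x'), Y.marking (F.functor.map f) → X.marking f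

instance : locEquivs.{u}.HasTwoOutOfThreeProperty :=
  inferInstanceAs (Cat.equivs.inverseImage loc).HasTwoOutOfThreeProperty

instance : locEquivs.{u}.IsStableUnderRetracts :=
  inferInstanceAs (Cat.equivs.inverseImage loc).IsStableUnderRetracts

instance : injOnObj.{u}.IsStableUnderRetracts :=
  inferInstanceAs (Cat.injOnObj.inverseImage forget).IsStableUnderRetracts

instance : surjEquivs.{u}.IsStableUnderRetracts where
  of_retract {X Y Z W F G} h hG := by
    refine ⟨of_retract (P := Cat.surjEquivs) (h.map forget) hG.1, fun x x' f hf => ?_⟩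
    have h₁ : Arrow.mk (h.r.left.functor.map (h.i.left.functor.map f)) = Arrow.mk f :=
      Functor.mk_map_congr_left (congrArg Hom.functor h.retract_left) f
    have h₂ : Arrow.mk (G.functor.map (h.i.left.functor.map f)) =
        Arrow.mk (h.i.right.functor.map (F.functor.map f)) :=
      Functor.mk_map_congr_left (congrArg Hom.functor h.i_w) f
    rw [← X.marking_congr h₁]
    refine h.r.left.map_marking _ (hG.2 _ ?_)
    rw [W.marking_congr h₂]
    exact h.i.right.map_marking _ hf

lemma hasLiftingProperty_surjEquivs {A B X Y : MarkedCat.{u}} (i : A ⟶ B) (p : X ⟶ Y)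
    (hi : injOnObj i) (hp : surjEquivs p) : HasLiftingProperty i p where
  sq_hasLift {f g} sq := by
    obtain ⟨l, h₁, h₂⟩ := hp.1.exists_lift hi f.functor g.functor (congrArg Hom.functor sq.w)
    refine ⟨⟨⟨l, fun φ hφ => hp.2 _ ?_⟩, hom_ext h₁, hom_ext h₂⟩⟩
    exact (Y.marking_congr (Functor.mk_map_congr_left h₂ φ)).2 (g.map_marking φ hφ)

/-- The mapping cylinder of a marked functor. -/
def cylinder {X Y : MarkedCat.{u}} (F : X ⟶ Y) : MarkedCat.{u} where
  cat := Cat.of (MappingCylinder F.functor)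
  marking _ _ f := Y.marking ((MappingCylinder.proj F.functor).map f)
  marking_id _ := Y.marking_id _

/-- The inclusion of the source in the mapping cylinder. -/
def cylinderInl {X Y : MarkedCat.{u}} (F : X ⟶ Y) : X ⟶ cylinder F where
  functor := MappingCylinder.inl F.functor
  map_marking f hf := F.map_marking f hf

/-- The projection from the mapping cylinder to the target. -/
def cylinderProj {X Y : MarkedCat.{u}} (F : X ⟶ Y) : cylinder F ⟶ Y where
  functor := MappingCylinder.proj F.functor
  map_marking _ hf := hf

lemma cylinderInl_comp_proj {X Y : MarkedCat.{u}} (F : X ⟶ Y) :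
    cylinderInl F ≫ cylinderProj F = F := rfl

lemma injOnObj_cylinderInl {X Y : MarkedCat.{u}} (F : X ⟶ Y) : injOnObj (cylinderInl F) :=
  MappingCylinder.inl_injective F.functor

lemma surjEquivs_cylinderProj {X Y : MarkedCat.{u}} (F : X ⟶ Y) : surjEquivs (cylinderProj F) :=
  ⟨MappingCylinder.isSurjEquiv_proj F.functor, fun _ _ _ h => h⟩

instance : HasFactorization injOnObj.{u} surjEquivs :=
  ⟨fun F => ⟨{
    Z := cylinder F
    i := cylinderInl F
    p := cylinderProj F
    hi := injOnObj_cylinderInl F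
    hp := surjEquivs_cylinderProj F }⟩⟩

instance : IsWeakFactorizationSystem injOnObj.{u} surjEquivs :=
  .mk' _ _ hasLiftingProperty_surjEquivs

/-- The functor `loc` sends isomorphic functors to isomorphic functors. -/
noncomputable def locMapIso {X Y : MarkedCat.{u}} (F G : X ⟶ Y) (e : F.functor ≅ G.functor) :
    (loc.map F).toFunctor ≅ (loc.map G).toFunctor :=
  letI : Localization.Lifting X.marking.Q X.marking (F.functor ⋙ Y.marking.Q)
      (loc.map F).toFunctor := ⟨eqToIso (Localization.Construction.fac _ _)⟩
  letI : Localization.Lifting X.marking.Q X.marking (G.functor ⋙ Y.marking.Q)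
      (loc.map G).toFunctor := ⟨eqToIso (Localization.Construction.fac _ _)⟩
  Localization.liftNatIso X.marking.Q X.marking (F.functor ⋙ Y.marking.Q)
    (G.functor ⋙ Y.marking.Q) _ _ (Functor.isoWhiskerRight e Y.marking.Q)

lemma surjEquivs_le_locEquivs : surjEquivs.{u} ≤ locEquivs := by
  intro X Y q hq
  have := hq.1.full
  have := hq.1.faithful
  -- Lifting the identity against the empty functor yields a strict section. It is a marked functor
  -- because `q` reflects markings, and `q ⋙ s ≅ 𝟭` can be checked after composing with the fully
  -- faithful `q`.
  obtain ⟨s, -, hs⟩ := hq.1.exists_lift (i := Functor.empty.{0} Y.cat) (fun x => x.as.elim)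
    (Functor.empty X.cat) (𝟭 Y.cat) (Functor.empty_ext' _ _)
  let S : Y ⟶ X :=
    { functor := s
      map_marking f hf := hq.2 _ ((Y.marking_congr (Functor.mk_map_congr_left hs f)).2 hf) }
  have hS : S ≫ q = 𝟙 Y := hom_ext hs
  let e : q.functor ⋙ s ≅ 𝟭 X.cat := Functor.fullyFaithfulCancelRight q.functor
    (Functor.isoWhiskerLeft q.functor (eqToIso hs))
  let η : 𝟭 _ ≅ (loc.map q).toFunctor ⋙ (loc.map S).toFunctor :=
    (eqToIso congr(($(loc.map_id X)).toFunctor)).symm ≪≫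
      (locMapIso (q ≫ S) (𝟙 X) e).symm ≪≫
      eqToIso congr(($(loc.map_comp q S)).toFunctor)
  let ε : (loc.map S).toFunctor ⋙ (loc.map q).toFunctor ≅ 𝟭 _ :=
    eqToIso congr(($((loc.map_comp S q).symm.trans ((congrArg loc.map hS).trans
      (loc.map_id Y)))).toFunctor)
  exact (Equivalence.mk _ _ η ε).isEquivalence_functor

instance : natural.{u}.Full where
  map_surjective F := ⟨F.functor.toCatHom, rfl⟩

instance : natural.{u}.Faithful where
  map_injective h := Cat.ext (congrArg Hom.functor h)

/-- Since `natural` is fully faithful, the counit is an isomorphism, so localizing `natural.map F`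
gives back `F`. -/
lemma locEquivs_natural_map {C D : Cat.{u, u}} (F : C ⟶ D) :
    locEquivs (natural.map F) ↔ F.toFunctor.IsEquivalence :=
  Cat.equivs.arrow_mk_iso_iff (Arrow.isoOfNatIso (asIso locAdj.counit) (Arrow.mk F))

lemma locEquivs_unit (X : MarkedCat.{u}) : locEquivs (locAdj.unit.app X) := by
  have : IsIso (loc.map (locAdj.unit.app X) ≫ locAdj.counit.app (loc.obj X)) := by
    rw [locAdj.left_triangle_components X]
    exact IsIso.id (loc.obj X)
  have : IsIso (loc.map (locAdj.unit.app X)) :=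
    IsIso.of_isIso_comp_right _ (locAdj.counit.app (loc.obj X))
  have : (loc.map (locAdj.unit.app X)).toFunctor.IsEquivalence :=
    (Cat.equivOfIso (asIso (loc.map (locAdj.unit.app X)))).isEquivalence_functor
  exact this

lemma injOnObj_unit (X : MarkedCat.{u}) : injOnObj (locAdj.unit.app X) := by
  change Function.Injective (Hom.functor (locAdj.unit.app X)).obj
  rw [locAdj_unit_functor]
  exact (Localization.Construction.objEquiv X.marking).injective

lemma injOnObj_loc_map_iff {X Y : MarkedCat.{u}} (F : X ⟶ Y) :
    Cat.injOnObj (loc.map F) ↔ injOnObj F := by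
  have h (x : X.cat) : (loc.map F).toFunctor.obj (X.marking.Q.obj x) =
    Y.marking.Q.obj (F.functor.obj x) := rfl
  constructor
  · intro hF x y hxy
    apply (Localization.Construction.objEquiv X.marking).injective
    apply hF
    exact (h x).trans ((congrArg Y.marking.Q.obj hxy).trans (h y).symm)
  · intro hF x y hxy
    obtain ⟨x, rfl⟩ := (Localization.Construction.objEquiv X.marking).surjective x
    obtain ⟨y, rfl⟩ := (Localization.Construction.objEquiv X.marking).surjective y
    exact congrArg _ (hF ((Localization.Construction.objEquiv Y.marking).injective hxy))

/-- By `injOnObj_loc_map_iff`, both conditions on `i` are conditions on `loc.map i`: it must be a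
trivial cofibration of `Cat`, that is, lift against isofibrations. The adjunction moves this lifting
problem back to `Cat⁺`. -/
lemma injOnObj_inf_locEquivs :
    injOnObj.{u} ⊓ locEquivs = (Cat.isofibs.strictMap natural).llp := by
  ext A B i
  have h : (injOnObj ⊓ locEquivs) i ↔ Cat.isofibs.llp (loc.map i) := by
    rw [llp_eq_of_wfs (Cat.injOnObj ⊓ Cat.equivs) Cat.isofibs]
    exact and_congr (injOnObj_loc_map_iff i).symm Iff.rfl
  rw [h]
  constructor
  · intro hi _ _ _ hp
    cases hp with
    | map hp => exact (locAdj.hasLiftingProperty_iff i _).1 (hi _ hp)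
  · intro hi X Y p hp
    exact (locAdj.hasLiftingProperty_iff i p).2 (hi _ ⟨hp⟩)

/-- The fibrations of marked categories. -/
def fibs : MorphismProperty MarkedCat.{u} := (injOnObj ⊓ locEquivs).rlp

lemma fibs_natural_map {C D : Cat.{u, u}} (F : C ⟶ D) (hF : F.toFunctor.IsIsofib) :
    fibs (natural.map F) := by
  intro A B i hi
  rw [injOnObj_inf_locEquivs] at hi
  exact hi _ ⟨hF⟩

/-- Retract argument: if `p` is a fibration and a weak equivalence, the first factor of its cylinder
factorization is a trivial cofibration by two-out-of-three. Then `p` lifts against it and is a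
retract of the second factor. -/
lemma fibs_inf_locEquivs : fibs.{u} ⊓ locEquivs = surjEquivs := by
  refine le_antisymm ?_ (le_inf ?_ surjEquivs_le_locEquivs)
  · rintro X Y p ⟨hp, hp'⟩
    have h := factorizationData injOnObj surjEquivs p
    have h' : locEquivs h.i := by
      refine locEquivs.of_postcomp h.i h.p (surjEquivs_le_locEquivs _ h.hp) ?_
      rwa [h.fac]
    have := hp _ ⟨h.hi, h'⟩
    exact of_retract (RetractArrow.ofRightLiftingProperty h.fac) h.hp
  · rw [← rlp_eq_of_wfs injOnObj surjEquivs]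
    exact antitone_rlp inf_le_left

end MarkedCat

/-- The functor `t` has the quasi-inverse `(s ⋙ t).inv ⋙ s` on one side and `e` on the other, so it
is an equivalence, and hence so is `s`. -/
lemma Functor.isEquivalence_of_comp_of_retraction {C D E : Type*} [Category* C] [Category* D]
    [Category* E] (s : C ⥤ D) (t : D ⥤ E) (e : E ⥤ D) [(s ⋙ t).IsEquivalence]
    (h : t ⋙ e = 𝟭 D) : s.IsEquivalence := by
  let l : E ⥤ D := (s ⋙ t).inv ⋙ s
  let ε : l ⋙ t ≅ 𝟭 E := (s ⋙ t).asEquivalence.counitIso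
  let ε' : e ⋙ t ≅ 𝟭 E :=
    Functor.isoWhiskerRight ε.symm (e ⋙ t) ≪≫
      Functor.isoWhiskerLeft l (Functor.isoWhiskerRight (eqToIso h) t) ≪≫ ε
  have : t.IsEquivalence := (Equivalence.mk t e (eqToIso h.symm) ε').isEquivalence_functor
  exact isEquivalence_of_comp_right s t

/-! ### Fibrant objects, and maps between them. -/

namespace MarkedCat

lemma isIso_point {x y : Discrete PUnit.{u + 1}} (f : x ⟶ y) : IsIso f := inferInstance

lemma isStronglyCartesian_toPoint_iff (X : MarkedCat.{u}) {x x' : X.cat} (f : x ⟶ x') :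
    X.toPoint.functor.IsStronglyCartesian (X.toPoint.functor.map f) f ↔ IsIso f := by
  constructor
  · intro h
    have : IsIso (X.toPoint.functor.map f) := isIso_point _
    exact Functor.IsStronglyCartesian.isIso_of_base_isIso X.toPoint.functor (X.toPoint.functor.map f) f
  · intro h
    infer_instance

lemma isFibered_toPoint (X : MarkedCat.{u}) : X.toPoint.functor.IsFibered := by
  refine Functor.IsFibered.of_exists_isStronglyCartesian fun a R f => ⟨a, 𝟙 a, ?_⟩
  have : X.toPoint.functor.IsHomLift f (𝟙 a) :=
    (Functor.isHomLift_iff_mk _ _ _).2 rfl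
  infer_instance

lemma isCartMarkedFibration_toPoint_iff (X : MarkedCat.{u}) :
    IsCartMarkedFibration X.toPoint ↔ X.marking = isomorphisms X.cat := by
  constructor
  · intro h
    ext x x' f
    exact (h.2 f).trans (X.isStronglyCartesian_toPoint_iff f)
  · intro h
    refine ⟨X.isFibered_toPoint, fun f => ?_⟩
    rw [h]
    exact (X.isStronglyCartesian_toPoint_iff f).symm

/-- A marked category whose marked morphisms are the isomorphisms is in the image of
the functor `natural`. -/
def isoNatural (X : MarkedCat.{u}) (h : X.marking = isomorphisms X.cat) :
    X ≅ natural.obj X.cat where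
  hom :=
    { functor := 𝟭 _
      map_marking f hf := by rwa [h] at hf }
  inv :=
    { functor := 𝟭 _
      map_marking f hf := by
        rw [h]
        exact hf }

/-- The point, with its only possible marking, is terminal. -/
def isTerminalNaturalPoint : IsTerminal (natural.obj point.{u}) :=
  IsTerminal.ofUniqueHom
    (fun _ => { functor := Functor.star _, map_marking := fun _ _ => isIso_point _ })
    (fun _ _ => hom_ext (Functor.punit_ext' _ _))

instance : fibs.{u}.IsStableUnderRetracts :=
  inferInstanceAs (injOnObj ⊓ locEquivs).rlp.IsStableUnderRetracts

lemma fibs_terminal_iff (X : MarkedCat.{u}) :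
    fibs (terminal.from X) ↔ X.marking = isomorphisms X.cat := by
  constructor
  · intro h
    have := h _ ⟨injOnObj_unit X, locEquivs_unit X⟩
    have sq : CommSq (𝟙 X) (locAdj.unit.app X) (terminal.from X) (terminal.from _) :=
      ⟨Subsingleton.elim _ _⟩
    -- The lift is a marked retraction of the unit. A marked arrow becomes invertible in the
    -- localization and so is invertible in `X`; an isomorphism becomes marked there and so is
    -- marked in `X`.
    have hr : (locAdj.unit.app X).functor ⋙ sq.lift.functor = 𝟭 X.cat :=
      congrArg Hom.functor sq.fac_left
    ext x x' f
    have hf' : Arrow.mk (sq.lift.functor.map ((locAdj.unit.app X).functor.map f)) = Arrow.mk f :=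
      Functor.mk_map_congr_left hr f
    constructor
    · intro hf
      have : IsIso ((locAdj.unit.app X).functor.map f) := (locAdj.unit.app X).map_marking f hf
      have h' := (inferInstance :
        IsIso (sq.lift.functor.map ((locAdj.unit.app X).functor.map f)))
      exact ((isomorphisms X.cat).arrow_mk_iso_iff (eqToIso hf')).1 h'
    · intro hf
      have : IsIso f := hf
      exact (X.marking_congr hf').1 (sq.lift.map_marking _
        (inferInstanceAs (IsIso ((locAdj.unit.app X).functor.map f))))
  · intro h
    let star : X.cat ⟶ point.{u} := (Functor.star X.cat).toCatHom
    have : fibs (natural.map star) :=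
      fibs_natural_map _ fun c d g => ⟨c, Iso.refl c, (Functor.isHomLift_iff_mk _ _ _).2 rfl⟩
    refine (fibs.arrow_mk_iso_iff (Arrow.isoMk (X.isoNatural h)
      (terminalIsTerminal.uniqueUpToIso isTerminalNaturalPoint)
      (isTerminalNaturalPoint.hom_ext _ _))).2 this

lemma locEquivs_iff_of_marking {X Y : MarkedCat.{u}} (F : X ⟶ Y)
    (hX : X.marking = isomorphisms X.cat) (hY : Y.marking = isomorphisms Y.cat) :
    locEquivs F ↔ F.functor.IsEquivalence :=
  (locEquivs.arrow_mk_iso_iff (Arrow.isoMk (f := Arrow.mk F)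
    (g := Arrow.mk (natural.map F.functor.toCatHom)) (X.isoNatural hX) (Y.isoNatural hY))).trans
    (locEquivs_natural_map _)

lemma fibs_iff_of_marking {X Y : MarkedCat.{u}} (F : X ⟶ Y)
    (hX : X.marking = isomorphisms X.cat) (hY : Y.marking = isomorphisms Y.cat) :
    fibs F ↔ F.functor.IsIsofib := by
  refine (fibs.arrow_mk_iso_iff (Arrow.isoMk (f := Arrow.mk F)
    (g := Arrow.mk (natural.map F.functor.toCatHom)) (X.isoNatural hX)
    (Y.isoNatural hY))).trans ⟨fun h => ?_, fibs_natural_map F.functor.toCatHom⟩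
  -- The first factor stays a trivial cofibration under `natural`, so `F` is a retract of the
  -- isofibration that is the second factor.
  have hfac := factorizationData (Cat.injOnObj ⊓ Cat.equivs) Cat.isofibs F.functor.toCatHom
  have := h (natural.map hfac.i) ⟨hfac.hi.1, (locEquivs_natural_map _).2 hfac.hi.2⟩
  have r := RetractArrow.ofRightLiftingProperty
    ((natural.map_comp _ _).symm.trans (congrArg natural.map hfac.fac))
  exact of_retract (P := Cat.isofibs) (r.map forget) hfac.hp

/-! ### The model structure on `Cat⁺`, granted the factorization proved by countable approximation.
-/

section

variable [HasFactorization (injOnObj.{u} ⊓ locEquivs) fibs]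

instance : IsWeakFactorizationSystem (injOnObj.{u} ⊓ locEquivs) fibs where
  rlp := rfl
  llp := by
    have : (injOnObj.{u} ⊓ locEquivs).IsStableUnderRetracts := inferInstance
    exact llp_eq_of_le_llp_of_hasFactorization_of_isStableUnderRetracts
      (fun _ _ _ hi _ _ _ hp => hp _ hi)

/-- The model structure for Grothendieck fibrations over the point. -/
@[reducible]
def grfibModelStructure : ModelCategory MarkedCat.{u} :=
  letI : CategoryWithWeakEquivalences MarkedCat.{u} := ⟨locEquivs⟩
  letI : CategoryWithCofibrations MarkedCat.{u} := ⟨injOnObj⟩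
  letI : CategoryWithFibrations MarkedCat.{u} := ⟨fibs⟩
  haveI : (weakEquivalences MarkedCat.{u}).HasTwoOutOfThreeProperty :=
    inferInstanceAs locEquivs.{u}.HasTwoOutOfThreeProperty
  haveI : IsWeakFactorizationSystem (cofibrations MarkedCat.{u}) (trivialFibrations MarkedCat) := by
    change IsWeakFactorizationSystem injOnObj.{u} (fibs ⊓ locEquivs)
    rw [fibs_inf_locEquivs]
    infer_instance
  haveI : IsWeakFactorizationSystem (trivialCofibrations MarkedCat.{u}) (fibrations MarkedCat) :=
    inferInstanceAs (IsWeakFactorizationSystem (injOnObj.{u} ⊓ locEquivs) fibs)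
  ModelCategory.mk' _

lemma isGrfibModelStructure : IsGrfibModelStructure grfibModelStructure.{u} where
  cofibration_iff F := by
    let _ := grfibModelStructure.{u}
    exact HomotopicalAlgebra.cofibration_iff F
  isFibrant_iff X := by
    let _ := grfibModelStructure.{u}
    rw [isCartMarkedFibration_toPoint_iff, ← fibs_terminal_iff]
    exact HomotopicalAlgebra.fibration_iff _
  weakEquivalence_iff {X Y} F hX hY := by
    let _ := grfibModelStructure.{u}
    exact (HomotopicalAlgebra.weakEquivalence_iff F).trans (locEquivs_iff_of_marking F
      ((fibs_terminal_iff X).1 ((HomotopicalAlgebra.fibration_iff _).1 hX))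
      ((fibs_terminal_iff Y).1 ((HomotopicalAlgebra.fibration_iff _).1 hY)))
  fibration_iff {X Y} F hX hY := by
    let _ := grfibModelStructure.{u}
    exact (HomotopicalAlgebra.fibration_iff F).trans (fibs_iff_of_marking F
      ((fibs_terminal_iff X).1 ((HomotopicalAlgebra.fibration_iff _).1 hX))
      ((fibs_terminal_iff Y).1 ((HomotopicalAlgebra.fibration_iff _).1 hY)))

end

end MarkedCat

/-! ### The Quillen equivalence, for arbitrary model structures with the stated properties. -/

section

open MarkedCat

variable {M : ModelCategory MarkedCat.{u}} (hM : IsGrfibModelStructure M)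

include hM

namespace IsGrfibModelStructure

lemma isFibrant_natural (C : Cat.{u, u}) : IsFibrant (natural.obj C) := by
  rw [hM.isFibrant_iff, isCartMarkedFibration_toPoint_iff]
  rfl

lemma weakEquivalence_natural_map_iff {C D : Cat.{u, u}} (F : C ⟶ D) :
    WeakEquivalence (natural.map F) ↔ F.toFunctor.IsEquivalence :=
  hM.weakEquivalence_iff _ (hM.isFibrant_natural C) (hM.isFibrant_natural D)

lemma fibration_natural_map_iff {C D : Cat.{u, u}} (F : C ⟶ D) :
    Fibration (natural.map F) ↔ F.toFunctor.IsIsofib :=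
  hM.fibration_iff _ (hM.isFibrant_natural C) (hM.isFibrant_natural D)

/-- A fibrant replacement of `X` has the form `j : X ⟶ natural.obj C`, so it factors as the unit
followed by `natural.map s`. By two-out-of-three it suffices that the transpose `s` is an
equivalence. -/
lemma weakEquivalence_unit (X : MarkedCat.{u}) : WeakEquivalence (locAdj.unit.app X) := by
  obtain ⟨C, j, _, _⟩ : ∃ (C : Cat.{u, u}) (j : X ⟶ natural.obj C),
      Cofibration j ∧ WeakEquivalence j := by
    have d := factorizationData (trivialCofibrations MarkedCat.{u}) (fibrations MarkedCat)
      (terminal.from X)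
    have h₁ := (mem_trivialCofibrations_iff d.i).1 d.hi
    have h₂ : IsFibrant d.Z := by
      rw [IsFibrant, Subsingleton.elim (terminal.from d.Z) d.p]
      exact ⟨d.hp⟩
    rw [hM.isFibrant_iff, isCartMarkedFibration_toPoint_iff] at h₂
    have := h₁.1
    have := h₁.2
    exact ⟨_, d.i ≫ (d.Z.isoNatural h₂).hom, inferInstance, inferInstance⟩
  let s : loc.obj X ⟶ C := (locAdj.homEquiv X C).symm j
  have hs : locAdj.unit.app X ≫ natural.map s = j := by
    exact (locAdj.homEquiv_unit X C s).symm.trans (Equiv.apply_symm_apply _ _)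
  have d := factorizationData (Cat.injOnObj ⊓ Cat.equivs) Cat.isofibs s
  have : Fibration (natural.map d.p) := (hM.fibration_natural_map_iff _).2 d.hp
  -- With `s` factored in `Cat` as an equivalence followed by an isofibration, the trivial
  -- cofibration `j` lifts against the image of the isofibration. By full faithfulness the lift is a
  -- functor `t` with `t ≫ d.p = 𝟙` and `s ≫ t = d.i`.
  have sq : CommSq (locAdj.unit.app X ≫ natural.map d.i) j (natural.map d.p) (𝟙 _) :=
    ⟨by rw [Category.assoc, ← natural.map_comp, d.fac, hs, Category.comp_id]⟩
  obtain ⟨t, ht⟩ := natural.map_surjective sq.lift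
  have h₁ : t ≫ d.p = 𝟙 C := natural.map_injective (by
    rw [natural.map_comp, ht, sq.fac_right, natural.map_id])
  have h₂ : s ≫ t = d.i := (locAdj.homEquiv _ _).injective (by
    rw [Adjunction.homEquiv_unit, Adjunction.homEquiv_unit, natural.map_comp,
      ← Category.assoc, hs, ht, sq.fac_left])
  have : (s.toFunctor ⋙ t.toFunctor).IsEquivalence := by
    change (s ≫ t).toFunctor.IsEquivalence
    rw [h₂]
    exact d.hi.2
  have hs' : WeakEquivalence (natural.map s) := (hM.weakEquivalence_natural_map_iff s).2
    (Functor.isEquivalence_of_comp_of_retraction s.toFunctor t.toFunctor d.p.toFunctor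
      congr(($h₁).toFunctor))
  exact weakEquivalence_of_postcomp_of_fac hs

end IsGrfibModelStructure

lemma IsGrfibModelStructure.isQuillenEquivalence {M' : ModelCategory Cat.{u, u}}
    (hM' : IsCanonicalModelStructure M') : locAdj.{u}.IsQuillenEquivalence where
  map_fibration p hp := (hM.fibration_natural_map_iff p).2 ((hM'.fibration_iff p).1 hp)
  map_trivialFibration p hp hp' := ⟨(hM.fibration_natural_map_iff p).2 ((hM'.fibration_iff p).1 hp),
    (hM.weakEquivalence_natural_map_iff p).2 ((hM'.weakEquivalence_iff p).1 hp')⟩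
  weakEquivalence_iff {X Y} _ _ f := by
    have := hM.weakEquivalence_unit X
    rw [hM'.weakEquivalence_iff, ← hM.weakEquivalence_natural_map_iff, Adjunction.homEquiv_unit]
    exact (weakEquivalence_precomp_iff _ _).symm

end

/-! ### σ-directed preorders and countable categories. -/

/-- A preorder in which every sequence has an upper bound. -/
class IsSigmaDirected (J : Type*) [Preorder J] : Prop where
  exists_ge (s : ℕ → J) : ∃ b, ∀ n, s n ≤ b

section SigmaDirected

variable {J : Type*} [Preorder J] [IsSigmaDirected J]

instance (priority := 100) IsSigmaDirected.isDirectedOrder : IsDirectedOrder J where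
  directed a b := by
    obtain ⟨c, hc⟩ := IsSigmaDirected.exists_ge (fun n : ℕ => if n = 0 then a else b)
    exact ⟨c, by simpa using hc 0, by simpa using hc 1⟩

lemma IsSigmaDirected.exists_ge_of_countable {ι : Type*} [Countable ι] (j₀ : J) (s : ι → J) :
    ∃ b, j₀ ≤ b ∧ ∀ i, s i ≤ b := by
  obtain hι | hι := isEmpty_or_nonempty ι
  · exact ⟨j₀, le_rfl, hι.elim⟩
  · obtain ⟨e, he⟩ := exists_surjective_nat ι
    obtain ⟨b, hb⟩ := exists_ge (fun n => s (e n))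
    obtain ⟨b', h, h'⟩ := exists_ge_ge j₀ b
    refine ⟨b', h, fun i => ?_⟩
    obtain ⟨n, rfl⟩ := he i
    exact (hb n).trans h'

/-- The main use of σ-directedness: countably many persistent conditions, each eventually true, hold
together at some stage. -/
lemma IsSigmaDirected.exists_forall {ι : Type*} [Countable ι] (j₀ : J)
    (P : ι → ∀ k : J, j₀ ≤ k → Prop)
    (mono : ∀ i k l (h : j₀ ≤ k) (h' : k ≤ l), P i k h → P i l (h.trans h'))
    (ex : ∀ i, ∃ k h, P i k h) : ∃ k h, ∀ i, P i k h := by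
  choose s hs hs' using ex
  obtain ⟨b, hb, hb'⟩ := exists_ge_of_countable j₀ s
  exact ⟨b, hb, fun i => mono i _ _ (hs i) (hb' i) (hs' i)⟩

end SigmaDirected

section CountableArrow

variable {A : Type*} [Category* A]

lemma countable_obj_of_countable_arrow [Countable (Arrow A)] : Countable A :=
  Function.Injective.countable (f := fun x : A => Arrow.mk (𝟙 x))
    fun _ _ h => Arrow.left_congr h

lemma countable_hom_of_countable_arrow [Countable (Arrow A)] (x y : A) : Countable (x ⟶ y) :=
  Function.Injective.countable (f := fun f : x ⟶ y => Arrow.mk f) (Arrow.mk_injective _ _)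

lemma countable_arrow_of_countable [Countable A] [∀ x y : A, Countable (x ⟶ y)] :
    Countable (Arrow A) :=
  Function.Surjective.countable (f := fun p : Σ x y : A, x ⟶ y => Arrow.mk p.2.2)
    fun f => ⟨⟨_, _, f.hom⟩, rfl⟩

end CountableArrow

/-! ### Countable marked categories are small with respect to σ-directed colimits. -/

namespace Cat

section

variable {J : Type*} [Preorder J] {F : J ⥤ Cat.{u, u}}

namespace IsTight

variable {c : Cocone F} (hc : IsTight c)

include hc

lemma exists_id {j : J} (a : Arrow (F.obj j)) (x : c.pt)
    (ha : (c.ι.app j).toFunctor.mapArrow.obj a = .mk (𝟙 x)) :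
    ∃ (k : J) (u : j ⟶ k), ∃ y, (F.map u).toFunctor.mapArrow.obj a = .mk (𝟙 y) := by
  obtain ⟨k, u, h⟩ := hc.inj j a (.mk (𝟙 a.left)) (by
    rw [ha]
    refine Eq.trans (Arrow.mk_id_congr (Arrow.left_congr ha).symm) ?_
    exact congrArg Arrow.mk (Functor.map_id _ _).symm)
  exact ⟨k, u, _, h.trans (congrArg Arrow.mk (Functor.map_id _ _))⟩

lemma exists_comp' [IsDirectedOrder J] {j : J} (a b d : Arrow (F.obj j)) {x y z : c.pt} (f : x ⟶ y) (g : y ⟶ z)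
    (ha : (c.ι.app j).toFunctor.mapArrow.obj a = .mk f)
    (hb : (c.ι.app j).toFunctor.mapArrow.obj b = .mk g)
    (hd : (c.ι.app j).toFunctor.mapArrow.obj d = .mk (f ≫ g)) :
    ∃ (k : J) (u : j ⟶ k) (x' y' z' : F.obj k) (f' : x' ⟶ y') (g' : y' ⟶ z'),
      (F.map u).toFunctor.mapArrow.obj a = .mk f' ∧
      (F.map u).toFunctor.mapArrow.obj b = .mk g' ∧
      (F.map u).toFunctor.mapArrow.obj d = .mk (f' ≫ g') := by
  obtain ⟨k, u, hu⟩ := hc.inj_obj j a.right b.left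
    ((Arrow.right_congr ha).trans (Arrow.left_congr hb).symm)
  rw [← mapArrow_w c u] at ha hb hd
  have hb' := (Functor.mk_map_congr (c.ι.app k).toFunctor
    (Arrow.arrow_mk_eqToHom_comp ((F.map u).toFunctor.map b.hom) hu)).trans hb
  obtain ⟨l, v, hv⟩ := hc.inj k ((F.map u).toFunctor.mapArrow.obj d)
    (.mk ((F.map u).toFunctor.map a.hom ≫ eqToHom hu ≫ (F.map u).toFunctor.map b.hom)) (by
      rw [hd]
      refine (Arrow.mk_comp_congr ha hb').symm.trans ?_
      exact congrArg Arrow.mk (Functor.map_comp _ _ _).symm)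
  refine ⟨l, u ≫ v, _, _, _, (F.map v).toFunctor.map ((F.map u).toFunctor.map a.hom),
    (F.map v).toFunctor.map (eqToHom hu ≫ (F.map u).toFunctor.map b.hom), ?_, ?_, ?_⟩
  · exact mapArrow_map_comp F u v a
  · refine (mapArrow_map_comp F u v b).trans (Functor.mk_map_congr _ ?_)
    exact (Arrow.arrow_mk_eqToHom_comp _ hu).symm
  · rw [mapArrow_map_comp, hv]
    exact congrArg Arrow.mk (Functor.map_comp _ _ _)

variable [IsSigmaDirected J]

lemma exists_lift_arrows [Nonempty J] {ι : Type*} [Countable ι] (a : ι → Arrow c.pt) :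
    ∃ (j : J) (b : ι → Arrow (F.obj j)), ∀ i, (c.ι.app j).toFunctor.mapArrow.obj (b i) = a i := by
  choose s b hb using fun i => hc.surj (a i)
  obtain ⟨j, -, hj⟩ := IsSigmaDirected.exists_ge_of_countable (Classical.arbitrary J) s
  exact ⟨j, fun i => (F.map (homOfLE (hj i))).toFunctor.mapArrow.obj (b i),
    fun i => (mapArrow_w c (homOfLE (hj i)) _).trans (hb i)⟩

lemma exists_lift [Nonempty J] {A : Type*} [Category* A] [Countable (Arrow A)] (φ : A ⥤ c.pt) :
    ∃ (j : J) (ψ : A ⥤ F.obj j), ψ ⋙ (c.ι.app j).toFunctor = φ := by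
  have : Countable A := countable_obj_of_countable_arrow
  have (x y : A) : Countable (x ⟶ y) := countable_hom_of_countable_arrow x y
  obtain ⟨j₀, b, hb⟩ := hc.exists_lift_arrows φ.mapArrow.obj
  -- The arrows of `A` have been lifted independently of one another. The next two stages repair the
  -- countably many identity laws, then the countably many composition laws.
  obtain ⟨j₁, h₁, hid⟩ := IsSigmaDirected.exists_forall j₀
    (fun (x : A) k h => ∃ y, (F.map (homOfLE h)).toFunctor.mapArrow.obj (b (.mk (𝟙 x))) = .mk (𝟙 y))
    (by
      rintro x k l h h' ⟨y, hy⟩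
      refine ⟨(F.map (homOfLE h')).toFunctor.obj y, ?_⟩
      rw [← homOfLE_comp h h', mapArrow_map_comp, hy]
      exact congrArg Arrow.mk (Functor.map_id _ _))
    (fun x => by
      obtain ⟨k, u, y, h⟩ := hc.exists_id (b (.mk (𝟙 x))) (φ.obj x) (by
        rw [hb]
        exact congrArg Arrow.mk (φ.map_id x))
      exact ⟨k, leOfHom u, y, h⟩)
  obtain ⟨j₂, h₂, hcomp⟩ := IsSigmaDirected.exists_forall j₁
    (fun (p : Σ x y z : A, (x ⟶ y) × (y ⟶ z)) k h => ∃ (x' y' z' : F.obj k) (f' : x' ⟶ y')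
      (g' : y' ⟶ z'),
      (F.map (homOfLE (h₁.trans h))).toFunctor.mapArrow.obj (b (.mk p.2.2.2.1)) = .mk f' ∧
      (F.map (homOfLE (h₁.trans h))).toFunctor.mapArrow.obj (b (.mk p.2.2.2.2)) = .mk g' ∧
      (F.map (homOfLE (h₁.trans h))).toFunctor.mapArrow.obj
        (b (.mk (p.2.2.2.1 ≫ p.2.2.2.2))) = .mk (f' ≫ g'))
    (by
      rintro p k l h h' ⟨x', y', z', f', g', e₁, e₂, e₃⟩
      refine ⟨_, _, _, (F.map (homOfLE h')).toFunctor.map f',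
        (F.map (homOfLE h')).toFunctor.map g', ?_, ?_, ?_⟩
      all_goals rw [← homOfLE_comp (h₁.trans h) h', mapArrow_map_comp]
      · rw [e₁]; rfl
      · rw [e₂]; rfl
      · rw [e₃]
        exact congrArg Arrow.mk (Functor.map_comp _ _ _))
    (by
      rintro ⟨x, y, z, f, g⟩
      obtain ⟨k, u, x', y', z', f', g', e₁, e₂, e₃⟩ := hc.exists_comp'
        ((F.map (homOfLE h₁)).toFunctor.mapArrow.obj (b (.mk f)))
        ((F.map (homOfLE h₁)).toFunctor.mapArrow.obj (b (.mk g)))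
        ((F.map (homOfLE h₁)).toFunctor.mapArrow.obj (b (.mk (f ≫ g))))
        (φ.map f) (φ.map g) (by rw [mapArrow_w, hb]; rfl) (by rw [mapArrow_w, hb]; rfl)
        (by rw [mapArrow_w, hb]; exact congrArg Arrow.mk (φ.map_comp f g))
      rw [← mapArrow_map_comp] at e₁ e₂ e₃
      exact ⟨k, leOfHom u, x', y', z', f', g', e₁, e₂, e₃⟩)
  let β (a : Arrow A) : Arrow (F.obj j₂) :=
    (F.map (homOfLE (h₁.trans h₂))).toFunctor.mapArrow.obj (b a)
  have hβ (x : A) : ∃ y, β (.mk (𝟙 x)) = .mk (𝟙 y) := by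
    obtain ⟨y, hy⟩ := hid x
    refine ⟨(F.map (homOfLE h₂)).toFunctor.obj y, ?_⟩
    dsimp only [β]
    rw [← homOfLE_comp h₁ h₂, mapArrow_map_comp, hy]
    exact congrArg Arrow.mk (Functor.map_id _ _)
  have hβ' {x y z : A} (f : x ⟶ y) (g : y ⟶ z) := hcomp ⟨x, y, z, f, g⟩
  refine ⟨j₂, Functor.ofArrows β hβ hβ', Arrow.functor_ext fun {x y} f => ?_⟩
  refine (Functor.mk_map_congr _ (Functor.ofArrows_map β hβ hβ' f)).trans ?_
  exact (mapArrow_w c (homOfLE (h₁.trans h₂)) _).trans (hb (.mk f))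

lemma exists_eq {A : Type*} [Category* A] [Countable (Arrow A)] {j : J} (ψ ψ' : A ⥤ F.obj j)
    (h : ψ ⋙ (c.ι.app j).toFunctor = ψ' ⋙ (c.ι.app j).toFunctor) :
    ∃ (k : J) (u : j ⟶ k), ψ ⋙ (F.map u).toFunctor = ψ' ⋙ (F.map u).toFunctor := by
  obtain ⟨k, u, hk⟩ := IsSigmaDirected.exists_forall j
    (fun (a : Arrow A) k h => (F.map (homOfLE h)).toFunctor.mapArrow.obj (ψ.mapArrow.obj a) =
      (F.map (homOfLE h)).toFunctor.mapArrow.obj (ψ'.mapArrow.obj a))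
    (by
      intro a k l h h' e
      rw [← homOfLE_comp h h', mapArrow_map_comp, e, ← mapArrow_map_comp])
    (fun a => by
      obtain ⟨k, u, e⟩ := hc.inj j (ψ.mapArrow.obj a) (ψ'.mapArrow.obj a)
        (Functor.mk_map_congr_left h a.hom)
      exact ⟨k, leOfHom u, e⟩)
  exact ⟨k, homOfLE u, Arrow.functor_ext fun _ _ f => hk (.mk f)⟩

end IsTight

end

end Cat

namespace MarkedCat

section

variable {J : Type u} [Preorder J] [IsSigmaDirected J] [Nonempty J] {F : J ⥤ MarkedCat.{u}}
  {c : Cocone F}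

lemma isTight_of_isColimit (hc : IsColimit c) : Cat.IsTight (forget.mapCocone c) :=
  Cat.isTight_of_isColimit (isColimitOfPreserves forget hc)

lemma exists_marking (hc : IsColimit c) {j : J} {x y : (F.obj j).cat} (f : x ⟶ y)
    (hf : c.pt.marking ((c.ι.app j).functor.map f)) :
    ∃ (k : J) (u : j ⟶ k), (F.obj k).marking ((F.map u).functor.map f) := by
  have ht := isTight_of_isColimit hc
  obtain ⟨z, hz⟩ | ⟨i, a, b, g, hg, h⟩ := isMarkedTight_of_isColimit hc _ hf
  · obtain ⟨k, u, y, h⟩ := ht.exists_id (.mk f) _ hz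
    exact ⟨k, u, ((F.obj k).marking_congr h).2 ((F.obj k).marking_id _)⟩
  · obtain ⟨k, u, v, h⟩ := ht.inj' (i := i) (j := j) (.mk g) (.mk f) h
    exact ⟨k, v, ((F.obj k).marking_congr h).1 ((F.map u).map_marking _ hg)⟩

variable {A : MarkedCat.{u}} [Countable (Arrow A.cat)]

lemma exists_lift (hc : IsColimit c) (φ : A ⟶ c.pt) :
    ∃ (j : J) (ψ : A ⟶ F.obj j), ψ ≫ c.ι.app j = φ := by
  have ht := isTight_of_isColimit hc
  obtain ⟨j, ψ, hψ⟩ := ht.exists_lift φ.functor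
  obtain ⟨k, h, hk⟩ := IsSigmaDirected.exists_forall j
    (fun (a : {a : Arrow A.cat // A.marking a.hom}) k h =>
      (F.obj k).marking ((F.map (homOfLE h)).functor.map (ψ.map a.1.hom)))
    (by
      intro a k l h h' e
      rw [← homOfLE_comp h h', F.map_comp]
      exact (F.map (homOfLE h')).map_marking _ e)
    (fun a => by
      obtain ⟨k, u, e⟩ := exists_marking hc (ψ.map a.1.hom)
        ((c.pt.marking_congr (Functor.mk_map_congr_left hψ a.1.hom)).2 (φ.map_marking _ a.2))
      exact ⟨k, leOfHom u, e⟩)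
  refine ⟨k, ⟨ψ ⋙ (F.map (homOfLE h)).functor, fun f hf => hk ⟨.mk f, hf⟩⟩, hom_ext ?_⟩
  refine Eq.trans ?_ hψ
  exact congrArg (ψ ⋙ ·) (congrArg Hom.functor (c.w (homOfLE h)))

lemma exists_eq (hc : IsColimit c) {j : J} (ψ ψ' : A ⟶ F.obj j)
    (h : ψ ≫ c.ι.app j = ψ' ≫ c.ι.app j) :
    ∃ (k : J) (u : j ⟶ k), ψ ≫ F.map u = ψ' ≫ F.map u := by
  obtain ⟨k, u, e⟩ := (isTight_of_isColimit hc).exists_eq ψ.functor ψ'.functor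
    (congrArg Hom.functor h)
  exact ⟨k, u, hom_ext e⟩

variable (F) in
instance preservesColimit_coyoneda : PreservesColimit F (coyoneda.obj (Opposite.op A)) where
  preserves {c} hc := ⟨Types.FilteredColimit.isColimitOf' _ _
    (fun φ => by
      obtain ⟨j, ψ, h⟩ := exists_lift hc φ
      exact ⟨j, ψ, h.symm⟩)
    (fun j ψ ψ' h => exists_eq hc ψ ψ' h)⟩

end

lemma isSigmaDirected_ordToType (κ : Cardinal.{u}) [Fact κ.IsRegular]
    (hκ : Cardinal.aleph0 < κ) : IsSigmaDirected κ.ord.ToType where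
  exists_ge s := by
    have hι : HasCardinalLT ℕ κ := by simpa [HasCardinalLT] using hκ
    exact ⟨IsCardinalFiltered.max s hι, fun n => leOfHom (IsCardinalFiltered.toMax s hι n)⟩

lemma hasSmallObjectArgument_of_countable (I : MorphismProperty MarkedCat.{u})
    [IsSmall.{u} I] (hI : ∀ ⦃A B : MarkedCat.{u}⦄ (i : A ⟶ B), I i → Countable (Arrow A.cat)) :
    HasSmallObjectArgument.{u} I := by
  -- Transfinite compositions of length ℵ₁ suffice: every sequence below the first uncountable
  -- ordinal is bounded, so functors out of countable sources factor through a stage.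
  have h₁ : Fact (Cardinal.aleph.{u} 1).IsRegular := ⟨Cardinal.isRegular_aleph_one⟩
  have h₂ : Nonempty (Cardinal.aleph.{u} 1).ord.ToType := IsCardinalFiltered.nonempty _ (Cardinal.aleph.{u} 1)
  let _ : OrderBot (Cardinal.aleph.{u} 1).ord.ToType := WellFoundedLT.toOrderBot _
  have := isSigmaDirected_ordToType (Cardinal.aleph.{u} 1) Cardinal.aleph0_lt_aleph_one
  exact ⟨_, h₁, inferInstance, {
    preservesColimit := fun i hi _ _ => by
      have := hI i hi
      infer_instance }⟩

end MarkedCat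

lemma Arrow.exists_mk_eq {C : Type*} [Category* C] {x y x' y' : C} (f : x ⟶ y) (hx : x = x')
    (hy : y = y') : ∃ f' : x' ⟶ y', Arrow.mk f' = Arrow.mk f := by
  subst hx hy
  exact ⟨f, rfl⟩

lemma Functor.obj_injective_of_mapArrow {C D : Type*} [Category* C] [Category* D] {F : C ⥤ D}
    (hF : F.mapArrow.obj.Injective) : F.obj.Injective := by
  intro x y h
  refine Arrow.left_congr (f := 𝟙 x) (f' := 𝟙 y) (hF ?_)
  simp only [Functor.mapArrow_obj, Arrow.mk_hom, Arrow.mk_left, Arrow.mk_right, Functor.map_id]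
  exact Arrow.mk_id_congr h

/-! ### Codes: a small set of representatives for countable marked categories. -/

namespace MarkedCat

/-- A marked category whose sets of objects and of morphisms are sets of natural numbers. -/
structure Code where
  /-- the objects -/
  obj : Set ℕ
  /-- the morphisms -/
  hom : obj → obj → Set ℕ
  /-- the identities -/
  id (x : obj) : hom x x
  /-- the composition -/
  comp {x y z : obj} : hom x y → hom y z → hom x z
  id_comp {x y : obj} (f : hom x y) : comp (id x) f = f
  comp_id {x y : obj} (f : hom x y) : comp f (id y) = f
  assoc {x y z t : obj} (f : hom x y) (g : hom y z) (h : hom z t) :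
    comp (comp f g) h = comp f (comp g h)
  /-- the marked morphisms -/
  marking {x y : obj} : hom x y → Prop
  marking_id (x : obj) : marking (id x)

namespace Code

variable (c : Code)

/-- The type of objects of the category attached to a code. -/
def Obj : Type u := ULift.{u} c.obj

instance : Category.{u} c.Obj where
  Hom x y := ULift.{u} (c.hom x.down y.down)
  id x := ⟨c.id x.down⟩
  comp f g := ⟨c.comp f.down g.down⟩
  id_comp f := congrArg ULift.up (c.id_comp f.down)
  comp_id f := congrArg ULift.up (c.comp_id f.down)
  assoc f g h := congrArg ULift.up (c.assoc f.down g.down h.down)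

/-- The marked category attached to a code. -/
def realize : MarkedCat.{u} where
  cat := Cat.of c.Obj
  marking _ _ f := c.marking (ULift.down f)
  marking_id x := c.marking_id (ULift.down x)

instance : Countable (Arrow c.realize.cat) := by
  have : Countable c.realize.cat := inferInstanceAs (Countable (ULift c.obj))
  have (x y : c.realize.cat) : Countable (x ⟶ y) :=
    inferInstanceAs (Countable (ULift (c.hom x.down y.down)))
  exact countable_arrow_of_countable

end Code

lemma exists_code (X : MarkedCat.{u}) [Countable (Arrow X.cat)] :
    ∃ c : Code, Nonempty (c.realize ≅ X) := by
  have : Countable X.cat := countable_obj_of_countable_arrow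
  have (x y : X.cat) : Countable (x ⟶ y) := countable_hom_of_countable_arrow x y
  obtain ⟨e, he⟩ := exists_injective_nat X.cat
  choose h hh using fun x y : X.cat => exists_injective_nat (x ⟶ y)
  let σ : Set.range e ≃ X.cat := (Equiv.ofInjective e he).symm
  let τ (x y : Set.range e) : Set.range (h (σ x) (σ y)) ≃ (σ x ⟶ σ y) :=
    (Equiv.ofInjective _ (hh _ _)).symm
  let c : Code :=
    { obj := Set.range e
      hom x y := Set.range (h (σ x) (σ y))
      id x := (τ x x).symm (𝟙 _)
      comp f g := (τ _ _).symm (τ _ _ f ≫ τ _ _ g)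
      id_comp f := by simp
      comp_id f := by simp
      assoc f g h := by simp
      marking f := X.marking (τ _ _ f)
      marking_id x := by
        rw [Equiv.apply_symm_apply]
        exact X.marking_id _ }
  let F : c.realize ⟶ X :=
    { functor :=
        { obj x := σ (ULift.down x)
          map f := τ _ _ (ULift.down f)
          map_id x := (τ _ _).apply_symm_apply _
          map_comp f g := (τ _ _).apply_symm_apply _ }
      map_marking f hf := hf }
  have h₁ : injOnObj F := fun x y hxy => ULift.down_injective (σ.injective hxy)
  have h₂ : surjEquivs F :=
    ⟨⟨fun x => ⟨⟨σ.symm x⟩, σ.apply_symm_apply x⟩,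
      ⟨fun f => ⟨⟨(τ _ _).symm f⟩, (τ _ _).apply_symm_apply f⟩⟩,
      ⟨fun {x y} f g hfg => ULift.down_injective ((τ x.down y.down).injective hfg)⟩⟩,
      fun _ _ _ hf => hf⟩
  -- The functor `F` lies in both classes of a weak factorization system, so it lifts against
  -- itself; the lift is its inverse.
  have := hasLiftingProperty_surjEquivs F F h₁ h₂
  have sq : CommSq (𝟙 _) F F (𝟙 _) := ⟨by simp⟩
  exact ⟨c, ⟨F, sq.lift, sq.fac_left, sq.fac_right⟩⟩

/-! ### Generating trivial cofibrations. -/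

/-- The marked functors between countable marked categories which are injective on objects and
induce equivalences on localizations. -/
def countableTrivCofs : MorphismProperty MarkedCat.{u} :=
  .ofHoms fun i : Σ a b : Code, {F : a.realize ⟶ b.realize // (injOnObj.{u} ⊓ locEquivs) F} =>
    i.2.2.1

instance : IsSmall.{u} countableTrivCofs.{u} :=
  isSmall_ofHoms.{u} _

instance : HasSmallObjectArgument.{u} countableTrivCofs.{u} := by
  refine hasSmallObjectArgument_of_countable _ fun A B i hi => ?_
  obtain ⟨i⟩ := hi
  infer_instance

/-- The trivial cofibrations are themselves a class of the form `llp`, so they contain the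
saturation of any of their subclasses. -/
lemma countableTrivCofs_rlp_llp_le : countableTrivCofs.{u}.rlp.llp ≤ injOnObj ⊓ locEquivs := by
  have h : countableTrivCofs.{u} ≤ injOnObj ⊓ locEquivs := by
    rintro _ _ _ ⟨i⟩
    exact i.2.2.2
  rw [injOnObj_inf_locEquivs] at h ⊢
  exact antitone_llp (le_llp_iff_le_rlp _ _ |>.1 h)

lemma hasLiftingProperty_of_countable {X Y A B : MarkedCat.{u}} {p : X ⟶ Y}
    (hp : countableTrivCofs.rlp p) (i : A ⟶ B) (hi : (injOnObj ⊓ locEquivs) i)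
    [Countable (Arrow A.cat)] [Countable (Arrow B.cat)] : HasLiftingProperty i p := by
  obtain ⟨a, ⟨α⟩⟩ := exists_code A
  obtain ⟨b, ⟨β⟩⟩ := exists_code B
  let j : a.realize ⟶ b.realize := α.hom ≫ i ≫ β.inv
  have e : Arrow.mk j ≅ Arrow.mk i := Arrow.isoMk α β (by simp [j])
  have : (injOnObj.{u} ⊓ locEquivs).RespectsIso := inferInstance
  have hj : (injOnObj ⊓ locEquivs) j := ((injOnObj ⊓ locEquivs).arrow_mk_iso_iff e).2 hi
  have := hp _ (.mk (f := fun i : Σ a b : Code,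
    {F : a.realize ⟶ b.realize // (injOnObj.{u} ⊓ locEquivs) F} => i.2.2.1) ⟨a, b, j, hj⟩)
  exact HasLiftingProperty.of_arrow_iso_left e p

instance {X Y : MarkedCat.{u}} (F : X ⟶ Y) [Countable (Arrow X.cat)] [Countable (Arrow Y.cat)] :
    Countable (Arrow (cylinder F).cat) := by
  have : Countable X.cat := countable_obj_of_countable_arrow
  have : Countable Y.cat := countable_obj_of_countable_arrow
  have : Countable (cylinder F).cat := inferInstanceAs (Countable (X.cat ⊕ Y.cat))
  have (x y : (cylinder F).cat) : Countable (x ⟶ y) := by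
    have := countable_hom_of_countable_arrow ((cylinderProj F).functor.obj x)
      ((cylinderProj F).functor.obj y)
    exact Function.Injective.countable (f := (cylinderProj F).functor.map)
      ((surjEquivs_cylinderProj F).1.faithful.map_injective)
  exact countable_arrow_of_countable

/-- A countable weak equivalence need not be injective on objects, but its cylinder inclusion is,
and is still a countable weak equivalence. -/
lemma exists_lift_cylinder {X Y A B : MarkedCat.{u}} {p : X ⟶ Y}
    (hp : countableTrivCofs.rlp p) (F : A ⟶ B) (hF : locEquivs F)
    [Countable (Arrow A.cat)] [Countable (Arrow B.cat)] (α : A ⟶ X) (β : B ⟶ Y)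
    (w : α ≫ p = F ≫ β) :
    ∃ l : cylinder F ⟶ X, cylinderInl F ≫ l = α ∧ l ≫ p = cylinderProj F ≫ β := by
  have := hasLiftingProperty_of_countable hp (cylinderInl F) ⟨injOnObj_cylinderInl F,
    locEquivs.of_postcomp _ (cylinderProj F)
      (surjEquivs_le_locEquivs _ (surjEquivs_cylinderProj F)) hF⟩
  have sq : CommSq α (cylinderInl F) p (cylinderProj F ≫ β) :=
    ⟨by rw [w, ← Category.assoc, cylinderInl_comp_proj]⟩
  exact ⟨sq.lift, sq.fac_left, sq.fac_right⟩

/-! ### From countable approximations to the factorization. -/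

/-- The condition that a marked functor `p` has countable approximations inducing equivalences on
localizations. -/
def HasCountableApproximations {X Y : MarkedCat.{u}} (p : X ⟶ Y) : Prop :=
  ∀ (s : Set (Arrow X.cat)) (t : Set (Arrow Y.cat)), s.Countable → t.Countable →
    ∃ (A B : MarkedCat.{u}) (_ : Countable (Arrow A.cat)) (_ : Countable (Arrow B.cat))
      (F : A ⟶ B) (α : A ⟶ X) (β : B ⟶ Y), locEquivs F ∧ α ≫ p = F ≫ β ∧
      α.functor.mapArrow.obj.Injective ∧ β.functor.mapArrow.obj.Injective ∧
      s ⊆ Set.range α.functor.mapArrow.obj ∧ t ⊆ Set.range β.functor.mapArrow.obj ∧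
      ∀ ⦃b b' : B.cat⦄ (f : b ⟶ b'), Y.marking (β.functor.map f) → B.marking f

/-- Each property of `p` concerns finitely many arrows, so an approximation `F : A ⟶ B` can be
chosen to contain them. A lift `cylinder F ⟶ X` extending `A ⟶ X` then settles it: hom-sets and
markings of the cylinder are computed in `B`, while its objects include those of `A`. -/
lemma HasCountableApproximations.surjEquivs {X Y : MarkedCat.{u}} {p : X ⟶ Y}
    (hp : HasCountableApproximations p) (hp' : countableTrivCofs.rlp p) :
    MarkedCat.surjEquivs p := by
  refine ⟨⟨fun y => ?_, ⟨fun {x x'} g => ?_⟩, ⟨fun {x x'} f f' hf => ?_⟩⟩, fun x x' f hf => ?_⟩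
  · obtain ⟨A, B, _, _, F, α, β, hF, w, hα, hβ, hs, ht, hm⟩ :=
      hp ∅ {.mk (𝟙 y)} (Set.to_countable _) (Set.to_countable _)
    obtain ⟨l, h₁, h₂⟩ := exists_lift_cylinder hp' F hF α β w
    obtain ⟨b, hb⟩ := ht (Set.mem_singleton _)
    refine ⟨l.functor.obj (Sum.inr b.left), ?_⟩
    exact (Functor.congr_obj (congrArg Hom.functor h₂) (Sum.inr b.left)).trans (Arrow.left_congr hb)
  · obtain ⟨A, B, _, _, F, α, β, hF, w, hα, hβ, hs, ht, hm⟩ :=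
      hp {.mk (𝟙 x), .mk (𝟙 x')} {.mk g} (Set.to_countable _) (Set.to_countable _)
    obtain ⟨l, h₁, h₂⟩ := exists_lift_cylinder hp' F hF α β w
    obtain ⟨a, ha⟩ := hs (Set.mem_insert _ _)
    obtain ⟨a', ha'⟩ := hs (Set.mem_insert_of_mem _ (Set.mem_singleton _))
    obtain ⟨b, hb⟩ := ht (Set.mem_singleton _)
    have w' (z : A.cat) : β.functor.obj (F.functor.obj z) = p.functor.obj (α.functor.obj z) :=
      (Functor.congr_obj (congrArg Hom.functor w) z).symm
    have e : F.functor.obj a.left = b.left := Functor.obj_injective_of_mapArrow hβ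
      ((w' _).trans ((congrArg p.functor.obj (Arrow.left_congr ha)).trans
        (Arrow.left_congr hb).symm))
    have e' : F.functor.obj a'.left = b.right := Functor.obj_injective_of_mapArrow hβ
      ((w' _).trans ((congrArg p.functor.obj (Arrow.left_congr ha')).trans
        (Arrow.right_congr hb).symm))
    have hl (z : A.cat) : l.functor.obj ((cylinderInl F).functor.obj z) = α.functor.obj z :=
      Functor.congr_obj (congrArg Hom.functor h₁) z
    -- Regarded in the cylinder, `g` is an arrow between objects of `A`; the lift sends it to an
    -- arrow from `x` to `x'` above `g`.
    let γ : (cylinderInl F).functor.obj a.left ⟶ (cylinderInl F).functor.obj a'.left :=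
      InducedCategory.homMk (eqToHom e ≫ b.hom ≫ eqToHom e'.symm)
    obtain ⟨f, hf⟩ := Arrow.exists_mk_eq (l.functor.map γ) ((hl _).trans (Arrow.left_congr ha))
      ((hl _).trans (Arrow.left_congr ha'))
    refine ⟨f, Arrow.mk_injective _ _ ?_⟩
    refine (p.functor.mk_map_congr hf).trans (Eq.trans ?_ hb)
    refine (Functor.mk_map_congr_left (congrArg Hom.functor h₂) γ).trans ?_
    refine β.functor.mk_map_congr (f := eqToHom e ≫ b.hom ≫ eqToHom e'.symm) ?_
    rw [Arrow.arrow_mk_eqToHom_comp, Arrow.arrow_mk_comp_eqToHom]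
  · obtain ⟨A, B, _, _, F, α, β, hF, w, hα, hβ, hs, ht, hm⟩ :=
      hp {.mk f, .mk f'} ∅ (Set.to_countable _) (Set.to_countable _)
    obtain ⟨l, h₁, h₂⟩ := exists_lift_cylinder hp' F hF α β w
    obtain ⟨a, ha⟩ := hs (Set.mem_insert _ _)
    obtain ⟨a', ha'⟩ := hs (Set.mem_insert_of_mem _ (Set.mem_singleton _))
    have w' (z : Arrow A.cat) : β.functor.mapArrow.obj (F.functor.mapArrow.obj z) =
        p.functor.mapArrow.obj (α.functor.mapArrow.obj z) :=
      (Functor.mk_map_congr_left (congrArg Hom.functor w) z.hom).symm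
    have hF' : F.functor.mapArrow.obj a = F.functor.mapArrow.obj a' := hβ (by
      rw [w', w', ha, ha']
      exact congrArg Arrow.mk hf)
    -- Two parallel arrows of `A` with the same image in `B` are already equal in the cylinder,
    -- hence after the lift.
    have hc : (cylinderInl F).functor.mapArrow.obj a = (cylinderInl F).functor.mapArrow.obj a' :=
      have := (surjEquivs_cylinderProj F).1.faithful
      Functor.arrow_ext_of_faithful (cylinderProj F).functor
        (congrArg (cylinderInl F).functor.obj (Functor.obj_injective_of_mapArrow hα
          ((Arrow.left_congr ha).trans (Arrow.left_congr ha').symm)))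
        (congrArg (cylinderInl F).functor.obj (Functor.obj_injective_of_mapArrow hα
          ((Arrow.right_congr ha).trans (Arrow.right_congr ha').symm))) hF'
    have hl (z : Arrow A.cat) : l.functor.mapArrow.obj
        ((cylinderInl F).functor.mapArrow.obj z) = α.functor.mapArrow.obj z :=
      Functor.mk_map_congr_left (congrArg Hom.functor h₁) z.hom
    refine Arrow.mk_injective _ _ ?_
    rw [← ha, ← ha', ← hl, ← hl, hc]
  · obtain ⟨A, B, _, _, F, α, β, hF, w, hα, hβ, hs, ht, hm⟩ :=
      hp {.mk f} ∅ (Set.to_countable _) (Set.to_countable _)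
    obtain ⟨l, h₁, h₂⟩ := exists_lift_cylinder hp' F hF α β w
    obtain ⟨a, ha⟩ := hs (Set.mem_singleton _)
    refine (X.marking_congr ((Functor.mk_map_congr_left (congrArg Hom.functor h₁) a.hom).trans ha)).1
      (l.map_marking _ (hm _ ?_))
    refine (Y.marking_congr ?_).1 hf
    exact (p.functor.mk_map_congr ha).symm.trans
      (Functor.mk_map_congr_left (congrArg Hom.functor w) a.hom)

/-- If the marked functors inducing equivalences on localizations have countable approximations,
then they can be combined with injectivity on objects to give one half of a weak factorization
system. -/
lemma hasFactorization_of_hasCountableApproximations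
    (h : ∀ ⦃X Y : MarkedCat.{u}⦄ (p : X ⟶ Y), locEquivs p → HasCountableApproximations p) :
    HasFactorization (injOnObj.{u} ⊓ locEquivs) fibs := by
  have hle : injOnObj.{u} ⊓ locEquivs ≤ countableTrivCofs.rlp.llp := by
    intro A B i hi
    have d := factorizationData countableTrivCofs.{u}.rlp.llp countableTrivCofs.{u}.rlp i
    -- Two-out-of-three makes the second factor a weak equivalence, hence a surjective equivalence
    -- by approximation. So `i` lifts against it and is a retract of the first factor.
    have hq : locEquivs d.p := by
      refine locEquivs.of_precomp d.i d.p (countableTrivCofs_rlp_llp_le _ d.hi).2 ?_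
      rw [d.fac]
      exact hi.2
    have := hasLiftingProperty_surjEquivs i d.p hi.1 ((h _ hq).surjEquivs d.hp)
    exact of_retract (RetractArrow.ofLeftLiftingProperty d.fac) d.hi
  have heq : injOnObj.{u} ⊓ locEquivs = countableTrivCofs.rlp.llp :=
    le_antisymm hle countableTrivCofs_rlp_llp_le
  have hfibs : fibs.{u} = countableTrivCofs.rlp := by
    rw [fibs, heq]
    exact rlp_llp_rlp _
  rw [heq, hfibs]
  infer_instance

end MarkedCat

/-! ### Equivalences between directed colimits, tested on stages. -/

namespace Cat

variable {J : Type*} [Preorder J] {F G : J ⥤ Cat.{u, u}}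

namespace IsTight

variable {c : Cocone F} (hc : IsTight c)

include hc

lemma exists_hom_eq {j : J} {a b : F.obj j} (f g : a ⟶ b)
    (h : (c.ι.app j).toFunctor.map f = (c.ι.app j).toFunctor.map g) :
    ∃ (k : J) (u : j ⟶ k), (F.map u).toFunctor.map f = (F.map u).toFunctor.map g := by
  obtain ⟨k, u, e⟩ := hc.inj j (.mk f) (.mk g) (congrArg Arrow.mk h)
  exact ⟨k, u, Arrow.mk_injective _ _ e⟩

variable [IsDirectedOrder J]

lemma exists_hom {j : J} (a b : F.obj j) {x y : c.pt} (g : x ⟶ y)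
    (hx : (c.ι.app j).toFunctor.obj a = x) (hy : (c.ι.app j).toFunctor.obj b = y) :
    ∃ (k : J) (u : j ⟶ k) (f : (F.map u).toFunctor.obj a ⟶ (F.map u).toFunctor.obj b),
      Arrow.mk ((c.ι.app k).toFunctor.map f) = Arrow.mk g := by
  obtain ⟨i, f, hf⟩ := hc.surj (.mk g)
  obtain ⟨k, u, v, huv⟩ := hc.inj' (i := i) (j := j) (.mk (𝟙 f.left)) (.mk (𝟙 a)) (by
    simp only [Functor.mapArrow_obj, Arrow.mk_hom, Arrow.mk_left, Arrow.mk_right, Functor.map_id]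
    exact Arrow.mk_id_congr ((Arrow.left_congr hf).trans hx.symm))
  obtain ⟨l, v', w, huw⟩ := hc.inj' (i := i) (j := j) (.mk (𝟙 f.right)) (.mk (𝟙 b)) (by
    simp only [Functor.mapArrow_obj, Arrow.mk_hom, Arrow.mk_left, Arrow.mk_right, Functor.map_id]
    exact Arrow.mk_id_congr ((Arrow.right_congr hf).trans hy.symm))
  obtain ⟨m, s, t⟩ := exists_ge_ge k l
  have h₁ := congrArg (F.map (homOfLE s)).toFunctor.mapArrow.obj huv
  have h₂ := congrArg (F.map (homOfLE t)).toFunctor.mapArrow.obj huw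
  simp only [← mapArrow_map_comp] at h₁ h₂
  obtain ⟨f', hf'⟩ := Arrow.exists_mk_eq
    ((F.map (u ≫ homOfLE s)).toFunctor.map f.hom) (Arrow.left_congr h₁)
    (Arrow.left_congr h₂)
  refine ⟨m, v ≫ homOfLE s, f', ?_⟩
  refine ((c.ι.app m).toFunctor.mk_map_congr hf').trans ?_
  exact (mapArrow_w c (u ≫ homOfLE s) f).trans hf

/-- Both directions are lifted first; each of the two inverse laws then requires passing to one more
stage. -/
lemma exists_iso {j : J} (a b : F.obj j)
    (e : (c.ι.app j).toFunctor.obj a ≅ (c.ι.app j).toFunctor.obj b) :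
    ∃ (k : J) (u : j ⟶ k), Nonempty ((F.map u).toFunctor.obj a ≅ (F.map u).toFunctor.obj b) := by
  obtain ⟨k, u, f, hf⟩ := hc.exists_hom a b e.hom rfl rfl
  obtain ⟨l, v, g, hg⟩ := hc.exists_hom ((F.map u).toFunctor.obj b) ((F.map u).toFunctor.obj a)
    e.inv (obj_w c u b) (obj_w c u a)
  have hf' := (mapArrow_w c v (.mk f)).trans hf
  obtain ⟨m, w, h⟩ := hc.exists_hom_eq ((F.map v).toFunctor.map f ≫ g) (𝟙 _) (by
    apply Arrow.mk_injective
    rw [Functor.map_comp, Functor.map_id]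
    refine (Arrow.mk_comp_congr hf' hg).trans ?_
    rw [e.hom_inv_id]
    exact (Arrow.mk_id_congr (Arrow.left_congr hf')).symm)
  obtain ⟨n, w', h'⟩ := hc.exists_hom_eq ((F.map w).toFunctor.map g ≫
    (F.map w).toFunctor.map ((F.map v).toFunctor.map f)) (𝟙 _) (by
    have hf'' := (mapArrow_w c w (.mk ((F.map v).toFunctor.map f))).trans hf'
    have hg' := (mapArrow_w c w (.mk g)).trans hg
    apply Arrow.mk_injective
    rw [Functor.map_comp, Functor.map_id]
    refine (Arrow.mk_comp_congr hg' hf'').trans ?_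
    rw [e.inv_hom_id]
    exact (Arrow.mk_id_congr (Arrow.left_congr hg')).symm)
  refine ⟨n, u ≫ v ≫ w ≫ w', ?_⟩
  simp only [Functor.map_comp]
  refine ⟨⟨(F.map w').toFunctor.map ((F.map w).toFunctor.map ((F.map v).toFunctor.map f)),
    (F.map w').toFunctor.map ((F.map w).toFunctor.map g), ?_, ?_⟩⟩
  · refine (Functor.map_comp _ _ _).symm.trans ?_
    refine (congrArg (F.map w').toFunctor.map ((Functor.map_comp _ _ _).symm.trans h)).trans ?_
    simp only [Functor.map_id]
    rfl
  · refine (Functor.map_comp _ _ _).symm.trans ?_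
    refine h'.trans ?_
    simp only [Functor.map_id]
    rfl

end IsTight

/-- A step of a diagram over which a natural transformation gets closer to an equivalence of
categories. -/
structure IsEquivStep (τ : F ⟶ G) {j k : J} (u : j ⟶ k) : Prop where
  essSurj (y : G.obj j) : ∃ x : F.obj k,
    Nonempty ((τ.app k).toFunctor.obj x ≅ (G.map u).toFunctor.obj y)
  full {x x' : F.obj j} (g : (τ.app j).toFunctor.obj x ⟶ (τ.app j).toFunctor.obj x') :
    ∃ f : (F.map u).toFunctor.obj x ⟶ (F.map u).toFunctor.obj x',
      Arrow.mk ((τ.app k).toFunctor.map f) = Arrow.mk ((G.map u).toFunctor.map g)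
  faithful {x x' : F.obj j} (f f' : x ⟶ x')
    (h : (τ.app j).toFunctor.map f = (τ.app j).toFunctor.map f') :
    (F.map u).toFunctor.map f = (F.map u).toFunctor.map f'

lemma naturality_obj (τ : F ⟶ G) {j k : J} (u : j ⟶ k) (x : F.obj j) :
    (τ.app k).toFunctor.obj ((F.map u).toFunctor.obj x) =
      (G.map u).toFunctor.obj ((τ.app j).toFunctor.obj x) :=
  Functor.congr_obj congr(($(τ.naturality u)).toFunctor) x

lemma naturality_map (τ : F ⟶ G) {j k : J} (u : j ⟶ k) {x x' : F.obj j} (f : x ⟶ x') :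
    Arrow.mk ((τ.app k).toFunctor.map ((F.map u).toFunctor.map f)) =
      Arrow.mk ((G.map u).toFunctor.map ((τ.app j).toFunctor.map f)) :=
  Functor.mk_map_congr_left congr(($(τ.naturality u)).toFunctor) f

section

variable {c : Cocone F} {d : Cocone G} (hc : IsTight c) (hd : IsTight d) (τ : F ⟶ G)
  (φ : c.pt ⟶ d.pt) (w : ∀ j, c.ι.app j ≫ φ = τ.app j ≫ d.ι.app j)

include hc hd w

/-- No single stage need be an equivalence. Objects and arrows of the colimits come from some stage
`j`, and the step out of `j` supplies preimages or equalities one stage later. -/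
lemma isEquivalence_of_isEquivStep [IsDirectedOrder J]
    (h : ∀ j : J, ∃ (k : J) (u : j ⟶ k), IsEquivStep τ u) : φ.toFunctor.IsEquivalence := by
  have wo (j : J) (x : F.obj j) : φ.toFunctor.obj ((c.ι.app j).toFunctor.obj x) =
    (d.ι.app j).toFunctor.obj ((τ.app j).toFunctor.obj x) :=
      Functor.congr_obj congr(($(w j)).toFunctor) x
  have wm (j : J) {x x' : F.obj j} (f : x ⟶ x') :
      Arrow.mk (φ.toFunctor.map ((c.ι.app j).toFunctor.map f)) =
      Arrow.mk ((d.ι.app j).toFunctor.map ((τ.app j).toFunctor.map f)) :=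
      Functor.mk_map_congr_left congr(($(w j)).toFunctor) f
  have objs (x x' : c.pt) : ∃ (j : J) (a a' : F.obj j), (c.ι.app j).toFunctor.obj a = x ∧
      (c.ι.app j).toFunctor.obj a' = x' := by
    obtain ⟨i, a, rfl⟩ := hc.surj_obj x
    obtain ⟨j, a', rfl⟩ := hc.surj_obj x'
    obtain ⟨k, u, v⟩ := exists_ge_ge i j
    exact ⟨k, _, _, obj_w c (homOfLE u) a, obj_w c (homOfLE v) a'⟩
  refine
    { essSurj := ⟨fun y => ?essSurj⟩
      full := ⟨fun {x x'} g => ?full⟩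
      faithful := ⟨fun {x x'} f f' hf => ?faithful⟩ }
  case essSurj =>
    obtain ⟨j, y, rfl⟩ := hd.surj_obj y
    obtain ⟨k, u, hu⟩ := h j
    obtain ⟨x, ⟨e⟩⟩ := hu.essSurj y
    exact ⟨(c.ι.app k).toFunctor.obj x, ⟨eqToIso (wo k x) ≪≫ (d.ι.app k).toFunctor.mapIso e ≪≫
      eqToIso (obj_w d u y)⟩⟩
  case full =>
    obtain ⟨i, a, a', rfl, rfl⟩ := objs x x'
    obtain ⟨j, u, g', hg'⟩ := hd.exists_hom ((τ.app i).toFunctor.obj a)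
      ((τ.app i).toFunctor.obj a') g (wo _ _).symm (wo _ _).symm
    obtain ⟨g'', hg''⟩ := Arrow.exists_mk_eq g' (naturality_obj τ u a).symm
      (naturality_obj τ u a').symm
    obtain ⟨k, v, hv⟩ := h j
    obtain ⟨f, hf⟩ := hv.full g''
    obtain ⟨f', hf'⟩ := Arrow.exists_mk_eq ((c.ι.app k).toFunctor.map f)
      ((obj_w c v _).trans (obj_w c u a)) ((obj_w c v _).trans (obj_w c u a'))
    refine ⟨f', Arrow.mk_injective _ _ ?_⟩
    refine (Functor.mk_map_congr _ hf').trans ((wm k f).trans ?_)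
    refine (Functor.mk_map_congr _ hf).trans ((mapArrow_w d v (.mk g'')).trans ?_)
    exact (Functor.mk_map_congr _ hg'').trans hg'
  case faithful =>
    obtain ⟨i, a, a', rfl, rfl⟩ := objs x x'
    obtain ⟨j, u, g, hg⟩ := hc.exists_hom a a' f rfl rfl
    obtain ⟨k, v, g', hg'⟩ := hc.exists_hom ((F.map u).toFunctor.obj a) ((F.map u).toFunctor.obj a')
      f' (obj_w c u a) (obj_w c u a')
    replace hg := (mapArrow_w c v (.mk g)).trans hg
    obtain ⟨l, s, hs⟩ := hd.exists_hom_eq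
      ((τ.app k).toFunctor.map ((F.map v).toFunctor.map g)) ((τ.app k).toFunctor.map g') (by
        apply Arrow.mk_injective
        refine (wm k _).symm.trans (Eq.trans ?_ (wm k _))
        refine (Functor.mk_map_congr _ hg).trans (Eq.trans ?_ (Functor.mk_map_congr _ hg').symm)
        exact congrArg Arrow.mk hf)
    obtain ⟨m, t, ht⟩ := h l
    have := ht.faithful ((F.map s).toFunctor.map ((F.map v).toFunctor.map g))
      ((F.map s).toFunctor.map g') (Arrow.mk_injective _ _ (by
        rw [naturality_map, naturality_map, hs]))
    apply Arrow.mk_injective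
    rw [← hg, ← hg']
    rw [← mapArrow_w c s, ← mapArrow_w c t]
    refine Eq.trans ?_ (mapArrow_w c s (.mk g'))
    refine Eq.trans ?_ (mapArrow_w c t _)
    exact congrArg (fun f => (c.ι.app m).toFunctor.mapArrow.obj (.mk f)) this

/-- Conversely, if `φ` is an equivalence, each object, arrow or pair of arrows of stage `j` has its
condition met in the colimit, hence at some later stage. There are countably many of them and the
conditions persist, so one stage serves all. -/
lemma exists_isEquivStep [IsSigmaDirected J] [∀ j, Countable (Arrow (F.obj j))]
    [∀ j, Countable (Arrow (G.obj j))] [φ.toFunctor.IsEquivalence] (j : J) :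
    ∃ (k : J) (u : j ⟶ k), IsEquivStep τ u := by
  have wo (j : J) (x : F.obj j) : φ.toFunctor.obj ((c.ι.app j).toFunctor.obj x) =
    (d.ι.app j).toFunctor.obj ((τ.app j).toFunctor.obj x) :=
      Functor.congr_obj congr(($(w j)).toFunctor) x
  have wm (j : J) {x x' : F.obj j} (f : x ⟶ x') :
      Arrow.mk (φ.toFunctor.map ((c.ι.app j).toFunctor.map f)) =
      Arrow.mk ((d.ι.app j).toFunctor.map ((τ.app j).toFunctor.map f)) :=
      Functor.mk_map_congr_left congr(($(w j)).toFunctor) f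
  have : Countable (F.obj j) := countable_obj_of_countable_arrow
  have : Countable (G.obj j) := countable_obj_of_countable_arrow
  have (x y : F.obj j) : Countable (x ⟶ y) := countable_hom_of_countable_arrow x y
  have (x y : G.obj j) : Countable (x ⟶ y) := countable_hom_of_countable_arrow x y
  let P₁ (y : G.obj j) (k : J) (u : j ≤ k) : Prop := ∃ x : F.obj k,
      Nonempty ((τ.app k).toFunctor.obj x ≅ (G.map (homOfLE u)).toFunctor.obj y)
  have m₁ (y k l u) (v : k ≤ l) : P₁ y k u → P₁ y l (u.trans v) := by
      rintro ⟨x, ⟨e⟩⟩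
      refine ⟨(F.map (homOfLE v)).toFunctor.obj x,
        ⟨eqToIso (naturality_obj τ (homOfLE v) x) ≪≫
          (G.map (homOfLE v)).toFunctor.mapIso e ≪≫ eqToIso ?_⟩⟩
      rw [← homOfLE_comp u v, G.map_comp]
      rfl
  obtain ⟨k₁, u₁, h₁⟩ := IsSigmaDirected.exists_forall j P₁ m₁ (by
      intro y
      obtain ⟨i, x, hx⟩ := hc.surj_obj (φ.toFunctor.objPreimage ((d.ι.app j).toFunctor.obj y))
      obtain ⟨k, u, v⟩ := exists_ge_ge i j
      have e : (d.ι.app k).toFunctor.obj ((τ.app k).toFunctor.obj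
          ((F.map (homOfLE u)).toFunctor.obj x)) ≅
          (d.ι.app k).toFunctor.obj ((G.map (homOfLE v)).toFunctor.obj y) :=
        eqToIso (by rw [← wo, obj_w, hx]) ≪≫ φ.toFunctor.objObjPreimageIso _ ≪≫
          eqToIso (obj_w d (homOfLE v) y).symm
      obtain ⟨l, t, ⟨e'⟩⟩ := hd.exists_iso _ _ e
      refine ⟨l, v.trans (leOfHom t), (F.map t).toFunctor.obj
        ((F.map (homOfLE u)).toFunctor.obj x),
        ⟨eqToIso (naturality_obj τ t _) ≪≫ e' ≪≫ eqToIso ?_⟩⟩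
      rw [← homOfLE_comp v (leOfHom t), G.map_comp]
      rfl)
  let P₂ (g : Σ x x' : F.obj j, (τ.app j).toFunctor.obj x ⟶ (τ.app j).toFunctor.obj x')
      (k : J) (u : j ≤ k) : Prop :=
      ∃ f : (F.map (homOfLE u)).toFunctor.obj g.1 ⟶ (F.map (homOfLE u)).toFunctor.obj g.2.1,
        Arrow.mk ((τ.app k).toFunctor.map f) =
          Arrow.mk ((G.map (homOfLE u)).toFunctor.map g.2.2)
  have m₂ (g k l u) (v : k ≤ l) : P₂ g k u → P₂ g l (u.trans v) := by
      obtain ⟨x, x', g⟩ := g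
      rintro ⟨f, hf⟩
      dsimp only [P₂]
      rw [← homOfLE_comp u v, F.map_comp, G.map_comp]
      refine ⟨(F.map (homOfLE v)).toFunctor.map f, ?_⟩
      exact (naturality_map τ (homOfLE v) f).trans (Functor.mk_map_congr _ hf)
  obtain ⟨k₂, u₂, h₂⟩ := IsSigmaDirected.exists_forall j P₂ m₂ (by
      rintro ⟨x, x', g⟩
      obtain ⟨g', hg'⟩ := Arrow.exists_mk_eq ((d.ι.app j).toFunctor.map g) (wo j x).symm
        (wo j x').symm
      obtain ⟨k, u, f, hf⟩ := hc.exists_hom x x' (φ.toFunctor.preimage g') rfl rfl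
      obtain ⟨l, v, h⟩ := hd.inj k (.mk ((τ.app k).toFunctor.map f))
        (.mk ((G.map u).toFunctor.map g)) (by
          refine (wm k f).symm.trans ((Functor.mk_map_congr _ hf).trans ?_)
          rw [φ.toFunctor.map_preimage, hg']
          exact (mapArrow_w d u (.mk g)).symm)
      refine ⟨l, leOfHom (u ≫ v), ?_⟩
      dsimp only [P₂]
      rw [show homOfLE (leOfHom (u ≫ v)) = u ≫ v from rfl, F.map_comp, G.map_comp]
      exact ⟨(F.map v).toFunctor.map f, (naturality_map τ v f).trans h⟩)
  let P₃ (p : {p : Σ x x' : F.obj j, (x ⟶ x') × (x ⟶ x') //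
      (τ.app j).toFunctor.map p.2.2.1 = (τ.app j).toFunctor.map p.2.2.2})
      (k : J) (u : j ≤ k) : Prop :=
      (F.map (homOfLE u)).toFunctor.mapArrow.obj (.mk p.1.2.2.1) =
        (F.map (homOfLE u)).toFunctor.mapArrow.obj (.mk p.1.2.2.2)
  have m₃ (p k l u) (v : k ≤ l) : P₃ p k u → P₃ p l (u.trans v) := by
      intro h
      dsimp only [P₃] at h ⊢
      rw [← homOfLE_comp u v, mapArrow_map_comp, h, ← mapArrow_map_comp]
  obtain ⟨k₃, u₃, h₃⟩ := IsSigmaDirected.exists_forall j P₃ m₃ (by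
      rintro ⟨⟨x, x', f, f'⟩, h⟩
      obtain ⟨k, u, h⟩ := hc.inj j (.mk f) (.mk f') (by
        refine congrArg Arrow.mk (φ.toFunctor.map_injective (Arrow.mk_injective _ _ ?_))
        refine (wm j f).trans (Eq.trans ?_ (wm j f').symm)
        exact congrArg (fun g => Arrow.mk ((d.ι.app j).toFunctor.map g)) h)
      exact ⟨k, leOfHom u, h⟩)
  obtain ⟨k', v₁, v₂⟩ := exists_ge_ge k₁ k₂
  obtain ⟨k, v, v₃⟩ := exists_ge_ge k' k₃
  exact ⟨k, homOfLE (u₃.trans v₃),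
    { essSurj := fun y => m₁ _ _ _ _ (v₁.trans v) (h₁ y)
      full := fun g => m₂ _ _ _ _ (v₂.trans v) (h₂ ⟨_, _, g⟩)
      faithful := fun f f' h =>
        Arrow.mk_injective _ _ (m₃ _ _ _ _ v₃ (h₃ ⟨⟨_, _, f, f'⟩, h⟩)) }⟩

end

end Cat

/-! ### Countable subcategories. -/

/-- A (non full) subcategory, given by its set of arrows. -/
structure ArrowSubcategory (C : Type*) [Category* C] where
  /-- the arrows of the subcategory -/
  carrier : Set (Arrow C)
  id_left {x y : C} (f : x ⟶ y) (hf : Arrow.mk f ∈ carrier) : Arrow.mk (𝟙 x) ∈ carrier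
  id_right {x y : C} (f : x ⟶ y) (hf : Arrow.mk f ∈ carrier) : Arrow.mk (𝟙 y) ∈ carrier
  comp {x y z : C} (f : x ⟶ y) (g : y ⟶ z) (hf : Arrow.mk f ∈ carrier)
    (hg : Arrow.mk g ∈ carrier) : Arrow.mk (f ≫ g) ∈ carrier

namespace ArrowSubcategory

section

variable {C D E : Type*} [Category* C] [Category* D] [Category* E]

/-- The objects of a subcategory. -/
def Obj (S : ArrowSubcategory C) := {x : C // Arrow.mk (𝟙 x) ∈ S.carrier}

instance (S : ArrowSubcategory C) : Category S.Obj where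
  Hom x y := {f : x.1 ⟶ y.1 // Arrow.mk f ∈ S.carrier}
  id x := ⟨𝟙 x.1, x.2⟩
  comp f g := ⟨f.1 ≫ g.1, S.comp _ _ f.2 g.2⟩
  id_comp f := Subtype.ext (Category.id_comp f.1)
  comp_id f := Subtype.ext (Category.comp_id f.1)
  assoc f g h := Subtype.ext (Category.assoc f.1 g.1 h.1)

/-- The inclusion of a subcategory. -/
def incl (S : ArrowSubcategory C) : S.Obj ⥤ C where
  obj x := x.1
  map f := f.1

lemma incl_mapArrow_injective (S : ArrowSubcategory C) : S.incl.mapArrow.obj.Injective := by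
  rintro ⟨x, y, f⟩ ⟨x', y', f'⟩ h
  obtain rfl : x = x' := Subtype.ext (Arrow.left_congr h)
  obtain rfl : y = y' := Subtype.ext (Arrow.right_congr h)
  obtain rfl : f = f' := Subtype.ext (Arrow.mk_injective _ _ h)
  rfl

lemma exists_incl_mapArrow (S : ArrowSubcategory C) (a : Arrow C) (ha : a ∈ S.carrier) :
    ∃ b, S.incl.mapArrow.obj b = a :=
  ⟨.mk (X := (⟨a.left, S.id_left a.hom ha⟩ : S.Obj)) (Y := ⟨a.right, S.id_right a.hom ha⟩)
    ⟨a.hom, ha⟩, rfl⟩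

lemma incl_mapArrow_mem (S : ArrowSubcategory C) (b : Arrow S.Obj) :
    S.incl.mapArrow.obj b ∈ S.carrier := b.hom.2

lemma countable_arrow (S : ArrowSubcategory C) (hS : S.carrier.Countable) :
    Countable (Arrow S.Obj) :=
  have := hS.to_subtype
  Function.Injective.countable (f := fun b => (⟨_, S.incl_mapArrow_mem b⟩ : S.carrier))
    fun _ _ h => S.incl_mapArrow_injective (congrArg Subtype.val h)

/-- The functor between subcategories induced by a functor. -/
def map (F : C ⥤ D) {S : ArrowSubcategory C} {T : ArrowSubcategory D}
    (h : ∀ a ∈ S.carrier, F.mapArrow.obj a ∈ T.carrier) : S.Obj ⥤ T.Obj where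
  obj x := ⟨F.obj x.1, by
    have := h _ x.2
    simpa only [Functor.mapArrow_obj, Arrow.mk_hom, Arrow.mk_left, Arrow.mk_right,
      Functor.map_id] using this⟩
  map f := ⟨F.map f.1, h _ f.2⟩
  map_id x := Subtype.ext (F.map_id x.1)
  map_comp f g := Subtype.ext (F.map_comp f.1 g.1)

end

section

variable {C : Type*} [Category* C]

/-- Adding to a set of arrows the identities of the sources and targets, and the compositions. -/
def addComp (s : Set (Arrow C)) : Set (Arrow C) :=
  s ∪ (fun a => .mk (𝟙 a.left)) '' s ∪ (fun a => .mk (𝟙 a.right)) '' s ∪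
    ⋃ a ∈ s, ⋃ b ∈ s, ⋃ h : a.right = b.left, {.mk (a.hom ≫ eqToHom h ≫ b.hom)}

lemma countable_addComp {s : Set (Arrow C)} (hs : s.Countable) : (addComp s).Countable :=
  ((hs.union (hs.image _)).union (hs.image _)).union
    (hs.biUnion fun _ _ => hs.biUnion fun _ _ => Set.countable_iUnion fun _ =>
      Set.countable_singleton _)

lemma subset_addComp (s : Set (Arrow C)) : s ⊆ addComp s :=
  fun _ h => Or.inl (Or.inl (Or.inl h))

/-- The subcategory generated by a set of arrows. -/
def closure (s : Set (Arrow C)) : ArrowSubcategory C :=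
  have mono : Monotone fun n => addComp^[n] s := monotone_nat_of_le_succ fun n => by
    rw [Function.iterate_succ_apply']
    exact subset_addComp _
  { carrier := ⋃ n, addComp^[n] s
    id_left f hf := by
      obtain ⟨n, hn⟩ := Set.mem_iUnion.1 hf
      refine Set.mem_iUnion.2 ⟨n + 1, ?_⟩
      rw [Function.iterate_succ_apply']
      exact Or.inl (Or.inl (Or.inr ⟨_, hn, rfl⟩))
    id_right f hf := by
      obtain ⟨n, hn⟩ := Set.mem_iUnion.1 hf
      refine Set.mem_iUnion.2 ⟨n + 1, ?_⟩
      rw [Function.iterate_succ_apply']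
      exact Or.inl (Or.inr ⟨_, hn, rfl⟩)
    comp f g hf hg := by
      obtain ⟨m, hm⟩ := Set.mem_iUnion.1 hf
      obtain ⟨n, hn⟩ := Set.mem_iUnion.1 hg
      -- Both arrows are present at step `max m n`, and their composite is added at the following
      -- one.
      refine Set.mem_iUnion.2 ⟨max m n + 1, ?_⟩
      rw [Function.iterate_succ_apply']
      refine Or.inr ?_
      simp only [Set.mem_iUnion]
      refine ⟨_, mono (le_max_left m n) hm, _, mono (le_max_right m n) hn, rfl, ?_⟩
      simp }

lemma subset_closure (s : Set (Arrow C)) : s ⊆ (closure s).carrier :=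
  fun _ h => Set.mem_iUnion.2 ⟨0, h⟩

lemma countable_closure {s : Set (Arrow C)} (hs : s.Countable) : (closure s).carrier.Countable := by
  refine Set.countable_iUnion fun n => ?_
  induction n with
  | zero => exact hs
  | succ n hn =>
    rw [Function.iterate_succ_apply']
    exact countable_addComp hn

/-- The union of an increasing sequence of subcategories. -/
def iUnion (S : ℕ → ArrowSubcategory C) (hS : Monotone fun n => (S n).carrier) :
    ArrowSubcategory C where
  carrier := ⋃ n, (S n).carrier
  id_left f hf := by
    obtain ⟨n, hn⟩ := Set.mem_iUnion.1 hf
    exact Set.mem_iUnion.2 ⟨n, (S n).id_left _ hn⟩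
  id_right f hf := by
    obtain ⟨n, hn⟩ := Set.mem_iUnion.1 hf
    exact Set.mem_iUnion.2 ⟨n, (S n).id_right _ hn⟩
  comp f g hf hg := by
    obtain ⟨m, hm⟩ := Set.mem_iUnion.1 hf
    obtain ⟨n, hn⟩ := Set.mem_iUnion.1 hg
    exact Set.mem_iUnion.2 ⟨max m n,
      (S _).comp _ _ (hS (le_max_left m n) hm) (hS (le_max_right m n) hn)⟩

end

end ArrowSubcategory

/-- The localization of a countable category is countable. -/
lemma countable_arrow_localization {C : Type*} [Category* C] [Countable (Arrow C)]
    (W : MorphismProperty C) : Countable (Arrow W.Localization) := by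
  let s : Set (Arrow W.Localization) := Set.range W.Q.mapArrow.obj ∪
    Set.range fun a : {a : Arrow C // W a.hom} => .mk (Localization.Construction.wInv a.1.hom a.2)
  have hs : s.Countable := (Set.countable_range _).union (Set.countable_range _)
  let S := ArrowSubcategory.closure s
  let P : MorphismProperty W.Localization := fun _ _ f => Arrow.mk f ∈ S.carrier
  have : P.IsStableUnderComposition := ⟨fun f g hf hg => S.comp f g hf hg⟩
  -- The localization is generated under composition by the images of arrows and the formal
  -- inverses, which are countably many.
  have hP : P = ⊤ := Localization.Construction.morphismProperty_eq_top P
    (fun _ _ f => ArrowSubcategory.subset_closure s (Or.inl ⟨.mk f, rfl⟩))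
    (fun _ _ w hw => ArrowSubcategory.subset_closure s (Or.inr ⟨⟨.mk w, hw⟩, rfl⟩))
  have hS : S.carrier = Set.univ := Set.eq_univ_of_forall fun f => by
    change P f.hom
    rw [hP]
    trivial
  exact Set.countable_univ_iff.1 (hS ▸ ArrowSubcategory.countable_closure hs)

/-! ### A marked functor as the σ-directed union of its countable restrictions. -/

namespace MarkedCat

/-- A cocone over a directed preorder is colimit if its legs are inclusions of subcategories with
the induced markings, which cover all the arrows of the point. -/
lemma nonempty_isColimit_of_injective {J : Type*} [Preorder J] [IsDirectedOrder J] [Nonempty J]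
    {F : J ⥤ MarkedCat.{u}} (c : Cocone F)
    (hinj : ∀ j, (c.ι.app j).functor.mapArrow.obj.Injective)
    (hmark : ∀ (j : J) ⦃x y : (F.obj j).cat⦄ (f : x ⟶ y),
      c.pt.marking ((c.ι.app j).functor.map f) → (F.obj j).marking f)
    (hsurj : ∀ a : Arrow c.pt.cat, ∃ (j : J) (b : Arrow (F.obj j).cat),
      (c.ι.app j).functor.mapArrow.obj b = a) : Nonempty (IsColimit c) := by
  have ht : Cat.IsTight (forget.mapCocone c) :=
    ⟨hsurj, fun j a b h => ⟨j, 𝟙 j, congrArg _ (hinj j h)⟩⟩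
  refine ⟨isColimitOfForget ht.isColimit fun x y f hf => Or.inr ?_⟩
  obtain ⟨j, b, hb⟩ := hsurj (.mk f)
  exact ⟨j, _, _, b.hom, hmark j _ ((c.pt.marking_congr hb).2 hf), hb⟩

/-- The marked category structure on a subcategory of a marked category. -/
def sub (X : MarkedCat.{u}) (S : ArrowSubcategory X.cat) : MarkedCat.{u} where
  cat := Cat.of S.Obj
  marking _ _ f := X.marking (S.incl.map f)
  marking_id _ := X.marking_id _

/-- The inclusion of a subcategory of a marked category. -/
def subι (X : MarkedCat.{u}) (S : ArrowSubcategory X.cat) : X.sub S ⟶ X where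
  functor := S.incl
  map_marking _ hf := hf

/-- The marked functor between subcategories induced by a marked functor. -/
def subMap {X Y : MarkedCat.{u}} (p : X ⟶ Y) {S : ArrowSubcategory X.cat}
    {T : ArrowSubcategory Y.cat}
    (h : ∀ a ∈ S.carrier, p.functor.mapArrow.obj a ∈ T.carrier) : X.sub S ⟶ Y.sub T where
  functor := ArrowSubcategory.map p.functor h
  map_marking _ hf := p.map_marking _ hf

/-- A pair of countable subcategories of the source and of the target of a marked functor `p`,
which are compatible with `p`. -/
structure CountablePair {X Y : MarkedCat.{u}} (p : X ⟶ Y) where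
  /-- the subcategory of the source -/
  S : ArrowSubcategory X.cat
  /-- the subcategory of the target -/
  T : ArrowSubcategory Y.cat
  hS : S.carrier.Countable
  hT : T.carrier.Countable
  h : ∀ a ∈ S.carrier, p.functor.mapArrow.obj a ∈ T.carrier

namespace CountablePair

variable {X Y : MarkedCat.{u}} (p : X ⟶ Y)

instance : Preorder (CountablePair p) :=
  Preorder.lift fun k => (k.S.carrier, k.T.carrier)

variable {p} in
lemma exists_subset {s : Set (Arrow X.cat)} {t : Set (Arrow Y.cat)} (hs : s.Countable)
    (ht : t.Countable) : ∃ k : CountablePair p, s ⊆ k.S.carrier ∧ t ⊆ k.T.carrier := by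
  have hs' := ArrowSubcategory.countable_closure hs
  exact ⟨{
    S := .closure s
    T := .closure (t ∪ p.functor.mapArrow.obj '' (ArrowSubcategory.closure s).carrier)
    hS := hs'
    hT := ArrowSubcategory.countable_closure (ht.union (hs'.image _))
    h := fun a ha => ArrowSubcategory.subset_closure _ (Or.inr ⟨a, ha, rfl⟩) },
    ArrowSubcategory.subset_closure _,
    Set.subset_union_left.trans (ArrowSubcategory.subset_closure _)⟩

instance : Nonempty (CountablePair p) :=
  ⟨(exists_subset Set.countable_empty Set.countable_empty).choose⟩

instance : IsSigmaDirected (CountablePair p) where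
  exists_ge k := by
    obtain ⟨l, hl, hl'⟩ := exists_subset (p := p) (Set.countable_iUnion fun n => (k n).hS)
      (Set.countable_iUnion fun n => (k n).hT)
    exact ⟨l, fun n => ⟨(Set.subset_iUnion _ n).trans hl, (Set.subset_iUnion _ n).trans hl'⟩⟩

/-- The functor sending a pair to its subcategory of the source. -/
def source : CountablePair p ⥤ MarkedCat.{u} where
  obj k := X.sub k.S
  map u := subMap (𝟙 X) (leOfHom u).1

/-- The functor sending a pair to its subcategory of the target. -/
def target : CountablePair p ⥤ MarkedCat.{u} where
  obj k := Y.sub k.T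
  map u := subMap (𝟙 Y) (leOfHom u).2

/-- The natural transformation induced by the functor on subcategories. -/
def sourceToTarget : source p ⟶ target p where
  app k := subMap p k.h

/-- The inclusions of the subcategories of the source. -/
def sourceCocone : Cocone (source p) where
  pt := X
  ι := { app k := X.subι k.S }

/-- The inclusions of the subcategories of the target. -/
def targetCocone : Cocone (target p) where
  pt := Y
  ι := { app k := Y.subι k.T }

lemma nonempty_isColimit_sourceCocone : Nonempty (IsColimit (sourceCocone p)) :=
  nonempty_isColimit_of_injective _ (fun k => k.S.incl_mapArrow_injective) (fun _ _ _ _ hf => hf)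
    fun a => by
      obtain ⟨k, h, -⟩ := exists_subset (p := p) (Set.countable_singleton a) Set.countable_empty
      exact ⟨k, k.S.exists_incl_mapArrow a (h rfl)⟩

lemma nonempty_isColimit_targetCocone : Nonempty (IsColimit (targetCocone p)) :=
  nonempty_isColimit_of_injective _ (fun k => k.T.incl_mapArrow_injective) (fun _ _ _ _ hf => hf)
    fun a => by
      obtain ⟨k, -, h⟩ := exists_subset (p := p) Set.countable_empty (Set.countable_singleton a)
      exact ⟨k, k.T.exists_incl_mapArrow a (h rfl)⟩

end CountablePair

end MarkedCat

/-! ### Existence of countable approximations. -/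

namespace MarkedCat

instance : loc.{u}.IsLeftAdjoint := locAdj.isLeftAdjoint

instance (X : MarkedCat.{u}) [Countable (Arrow X.cat)] : Countable (Arrow (loc.obj X)) :=
  countable_arrow_localization X.marking

namespace CountablePair

variable {X Y : MarkedCat.{u}} (p : X ⟶ Y)

instance (k : CountablePair p) : Countable (Arrow ((source p).obj k).cat) :=
  k.S.countable_arrow k.hS

instance (k : CountablePair p) : Countable (Arrow ((target p).obj k).cat) :=
  k.T.countable_arrow k.hT

/-- The natural transformation induced by the functor on localizations of subcategories. -/
noncomputable def locSourceToTarget : source p ⋙ loc ⟶ target p ⋙ loc :=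
  Functor.whiskerRight (sourceToTarget p) loc

/-- Localization preserves the two σ-directed colimits and keeps their stages countable, so
`Cat.exists_isEquivStep` applies to the localized diagrams. -/
lemma exists_isEquivStep (hp : locEquivs p) (k : CountablePair p) :
    ∃ (l : CountablePair p) (u : k ⟶ l), Cat.IsEquivStep (locSourceToTarget p) u := by
  obtain ⟨hc⟩ := nonempty_isColimit_sourceCocone p
  obtain ⟨hd⟩ := nonempty_isColimit_targetCocone p
  let φ : (loc.mapCocone (sourceCocone p)).pt ⟶ (loc.mapCocone (targetCocone p)).pt := loc.map p
  have : φ.toFunctor.IsEquivalence := hp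
  have (k : CountablePair p) : Countable (Arrow ((source p ⋙ loc).obj k)) :=
    inferInstanceAs (Countable (Arrow (loc.obj ((source p).obj k))))
  have (k : CountablePair p) : Countable (Arrow ((target p ⋙ loc).obj k)) :=
    inferInstanceAs (Countable (Arrow (loc.obj ((target p).obj k))))
  exact Cat.exists_isEquivStep
    (Cat.isTight_of_isColimit (isColimitOfPreserves loc hc))
    (Cat.isTight_of_isColimit (isColimitOfPreserves loc hd))
    (locSourceToTarget p) φ
    (fun k => (loc.map_comp (X.subι k.S) p).symm.trans
      (loc.map_comp ((sourceToTarget p).app k) (Y.subι k.T))) k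

section

variable {p} {k : ℕ → CountablePair p} (hk : Monotone k)

/-- The union of an increasing sequence of pairs. -/
def iUnion : CountablePair p where
  S := .iUnion (fun n => (k n).S) (fun _ _ h => (hk h).1)
  T := .iUnion (fun n => (k n).T) (fun _ _ h => (hk h).2)
  hS := Set.countable_iUnion fun n => (k n).hS
  hT := Set.countable_iUnion fun n => (k n).hT
  h a ha := by
    obtain ⟨n, hn⟩ := Set.mem_iUnion.1 ha
    exact Set.mem_iUnion.2 ⟨n, (k n).h a hn⟩

lemma le_iUnion (n : ℕ) : k n ≤ iUnion hk :=
  ⟨Set.subset_iUnion (fun n => (k n).S.carrier) n, Set.subset_iUnion (fun n => (k n).T.carrier) n⟩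

/-- An increasing sequence of pairs, as a functor. -/
def chain : ULift.{u} ℕ ⥤ CountablePair p :=
  -- The index is lifted to universe `u` because `Cat.isTight_of_isColimit` is stated for diagrams
  -- indexed there.
  Monotone.functor (f := fun n : ULift.{u} ℕ => k n.down) fun _ _ h => hk h

/-- The union of an increasing sequence of pairs, as a cocone. -/
def chainCocone : Cocone (chain hk) where
  pt := iUnion hk
  ι := { app n := homOfLE (le_iUnion hk n.down) }

lemma nonempty_isColimit_mapCocone_source :
    Nonempty (IsColimit ((source p).mapCocone (chainCocone hk))) := by
  refine nonempty_isColimit_of_injective _ (fun n a b h => ?_) (fun _ _ _ _ hf => hf) fun a => ?_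
  · exact (k n.down).S.incl_mapArrow_injective
      (congrArg (iUnion hk).S.incl.mapArrow.obj h)
  · obtain ⟨n, hn⟩ := Set.mem_iUnion.1 ((iUnion hk).S.incl_mapArrow_mem a)
    obtain ⟨b, hb⟩ := (k n).S.exists_incl_mapArrow _ hn
    exact ⟨⟨n⟩, b, (iUnion hk).S.incl_mapArrow_injective hb⟩

lemma nonempty_isColimit_mapCocone_target :
    Nonempty (IsColimit ((target p).mapCocone (chainCocone hk))) := by
  refine nonempty_isColimit_of_injective _ (fun n a b h => ?_) (fun _ _ _ _ hf => hf) fun a => ?_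
  · exact (k n.down).T.incl_mapArrow_injective
      (congrArg (iUnion hk).T.incl.mapArrow.obj h)
  · obtain ⟨n, hn⟩ := Set.mem_iUnion.1 ((iUnion hk).T.incl_mapArrow_mem a)
    obtain ⟨b, hb⟩ := (k n).T.exists_incl_mapArrow _ hn
    exact ⟨⟨n⟩, b, (iUnion hk).T.incl_mapArrow_injective hb⟩

lemma locEquivs_iUnion
    (h : ∀ n, Cat.IsEquivStep (locSourceToTarget p) (homOfLE (hk (Nat.le_add_right n 1)))) :
    locEquivs ((sourceToTarget p).app (iUnion hk)) := by
  obtain ⟨hc⟩ := nonempty_isColimit_mapCocone_source hk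
  obtain ⟨hd⟩ := nonempty_isColimit_mapCocone_target hk
  exact Cat.isEquivalence_of_isEquivStep
    (Cat.isTight_of_isColimit (isColimitOfPreserves loc hc))
    (Cat.isTight_of_isColimit (isColimitOfPreserves loc hd))
    (Functor.whiskerRight (Functor.whiskerLeft (chain hk) (sourceToTarget p)) loc)
    (loc.map ((sourceToTarget p).app (iUnion hk)))
    (fun n => (loc.map_comp ((source p).map (homOfLE (le_iUnion hk n.down))) _).symm.trans
      (loc.map_comp ((sourceToTarget p).app (k n.down))
        ((target p).map (homOfLE (le_iUnion hk n.down)))))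
    (fun n => ⟨⟨n.down + 1⟩, homOfLE (Nat.le_add_right n.down 1),
      (h n.down).essSurj, (h n.down).full, (h n.down).faithful⟩)

end

end CountablePair

/-- Closing-off argument: start from a countable pair containing `s` and `t`, iterate the choice of
an equivalence step, and take the union of the resulting sequence. It is still countable, and its
restriction of `p` is a weak equivalence by `locEquivs_iUnion`. -/
lemma hasCountableApproximations {X Y : MarkedCat.{u}} (p : X ⟶ Y) (hp : locEquivs p) :
    HasCountableApproximations p := by
  intro s t hs ht
  obtain ⟨k₀, h₁, h₂⟩ := CountablePair.exists_subset (p := p) hs ht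
  choose next u hu using CountablePair.exists_isEquivStep p hp
  let k (n : ℕ) : CountablePair p := next^[n] k₀
  have hk' (n : ℕ) : k (n + 1) = next (k n) := Function.iterate_succ_apply' _ _ _
  have hk : Monotone k := monotone_nat_of_le_succ fun n => by
    rw [hk']
    exact leOfHom (u (k n))
  have hstep (n : ℕ) : Cat.IsEquivStep (CountablePair.locSourceToTarget p)
      (homOfLE (hk (Nat.le_add_right n 1))) := by
    have key (l : CountablePair p) (hl : l = next (k n)) (v : k n ⟶ l) :
        Cat.IsEquivStep (CountablePair.locSourceToTarget p) v := by
      subst hl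
      obtain rfl : v = u (k n) := Subsingleton.elim _ _
      exact hu (k n)
    exact key _ (hk' n) _
  let l := CountablePair.iUnion hk
  refine ⟨(CountablePair.source p).obj l, (CountablePair.target p).obj l, inferInstance,
    inferInstance, (CountablePair.sourceToTarget p).app l, X.subι l.S, Y.subι l.T,
    CountablePair.locEquivs_iUnion hk hstep, rfl, l.S.incl_mapArrow_injective,
    l.T.incl_mapArrow_injective, fun a ha => ?_, fun a ha => ?_, fun _ _ _ hf => hf⟩
  · exact l.S.exists_incl_mapArrow a ((CountablePair.le_iUnion hk 0).1 (h₁ ha))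
  · exact l.T.exists_incl_mapArrow a ((CountablePair.le_iUnion hk 0).2 (h₂ ha))

instance : HasFactorization (injOnObj.{u} ⊓ locEquivs) fibs :=
  hasFactorization_of_hasCountableApproximations fun _ _ p hp => hasCountableApproximations p hp

end MarkedCat

end CategoryTheory

theorem mainTheorem8 :
    (∃ M : ModelCategory Cat.{u, u}, IsCanonicalModelStructure M) ∧
    (∃ M : ModelCategory MarkedCat.{u}, IsGrfibModelStructure M) ∧
    ∀ (M₁ : ModelCategory Cat.{u, u}) (M₂ : ModelCategory MarkedCat.{u}),
      IsCanonicalModelStructure M₁ → IsGrfibModelStructure M₂ →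
        MarkedCat.locAdj.{u}.IsQuillenEquivalence := by
  exact ⟨⟨_, Cat.isCanonicalModelStructure⟩, ⟨_, MarkedCat.isGrfibModelStructure⟩,
    fun _ _ h₁ h₂ => h₂.isQuillenEquivalence h₁⟩
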